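/- **Setting.** A transmitter observes a two-state symmetric Markov source that flips in each slot with probability $p\in(0,\tfrac12]$. Each update it sends takes a random time $T\in\{1,2,\dots\}$ (i.i.d., with $p_t=\Pr(T=t)$). A transmission lasts at most $t_{max}>1$ slots: an update that has not been delivered at the end of the $t_{max}$-th slot is discarded and the channel becomes idle (if $\sum_{t=1}^{t_{max}}p_t=1$, every update is delivered in time and nothing is ever discarded). The receiver's estimate is the last received update. The age of incorrect information $\Delta$ evolves as $\Delta_{k+1}=(\Delta_k+1)\mathbb 1\{\text{the estimate is wrong in slot }k+1\}$. Let $\mathcal M$ be the Markov decision process with states $s=(\Delta,t,i)$, where $\Delta\in\{0,1,2,\dots\}$, $t\in\{0,\dots,t_{max}-1\}$ is the time for which the current transmission has been in progress, and $i=-1$ (equivalently $t=0$) if the channel is idle, while $i=0$ (resp. $i=1$) if the update being transmitted equals (resp. differs from) the receiver's estimate. The actions are $a\in\{0,1\}$ (idle or transmit) when $i=-1$, and only $a=0$ when $i\ne-1$; the cost is $C(s)=\Delta$; the transition probabilities $P_{s,s'}(a)$ are those of the system just described (the probability that a transmission in progress for $t$ slots is not delivered in the next slot is $\Pr(T>t+1)/\Pr(T>t)$).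 A policy (possibly history-dependent and randomized) is optimal if, from every initial state, it minimizes $\limsup_{K\to\infty}\frac1K\mathbb E\sum_{k<K}C(s_k)$ among all policies; a stationary policy chooses one action for each state. For $m\ge0$, let $\mathcal M^{(m)}$ be the process on $\mathcal S^{(m)}=\{s:\Delta\le m\}$ with the same actions and cost, in which each transition to a state $(\Delta,t,i)$ with $\Delta>m$ is redirected to $(m,t,i)$. Relative value iteration on $\mathcal M^{(m)}$ with reference state $s^{ref}$ and tolerance $\epsilon>0$ starts with $V_0=0$ and computes $H_{s,a}=C(s)+\sum_{s'}P^{(m)}_{s,s'}(a)V_\nu(s')$, $Q_{\nu+1}(s)=\min_aH_{s,a}$, $V_{\nu+1}(s)=Q_{\nu+1}(s)-Q_{\nu+1}(s^{ref})$, until $\max_s|V_{\nu+1}(s)-V_\nu(s)|\le\epsilon$ for the first time; it then returns a stationary policy that chooses in each $s$ a minimizer of the last $H_{s,a}$. **Theorem 5.** The optimal policies of $\mathcal M^{(m)}$ converge to optimal policies of $\mathcal M$ as $m\to\infty$, and relative value iteration on $\mathcal M^{(m)}$ approximates an optimal policy of $\mathcal M$. Precisely: 1. For each $m$ there is an optimal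 stationary policy for $\mathcal M^{(m)}$. 2. If $f^{(m)}$ is an optimal stationary policy for $\mathcal M^{(m)}$ for each $m$, then the sequence $(f^{(m)})$ has a limit point (a stationary policy of $\mathcal M$ with which, along a subsequence, it eventually agrees in each state), and every limit point is optimal for $\mathcal M$. 3. For each finite set $F$ of states of $\mathcal M$ there is $m_0$ such that, for all $m\ge m_0$, every optimal stationary policy of $\mathcal M^{(m)}$ agrees on $F$ with some optimal stationary policy of $\mathcal M$. 4. For all $m$, $s^{ref}\in\mathcal S^{(m)}$ and $\epsilon>0$, relative value iteration on $\mathcal M^{(m)}$ halts; and there is $\epsilon_0>0$ (depending on $m$ and $s^{ref}$) such that for $0<\epsilon\le\epsilon_0$ every policy it can return is optimal for $\mathcal M^{(m)}$. 5. Hence for each finite set $F$ of states there is $m_0$ such that, for all $m\ge m_0$ and $s^{ref}\in\mathcal S^{(m)}$, there is $\epsilon_0>0$ such that for $0<\epsilon\le\epsilon_0$ every policy returned by relative value iteration on $\mathcal M^{(m)}$ agrees on $F$ with some optimal stationary policy of $\mathcal M$. -/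

import Mathlib

open Filter
open scoped ENNReal NNReal

namespace AoII

/-! ### Average-cost Markov decision processes -/

/-- A Markov decision process with state space `S`, action space `A`, a nonempty finite set of
feasible actions in each state, transition probabilities and a nonnegative immediate cost. -/
structure MDP (S A : Type) where
  actions : S → Finset A
  actions_nonempty : ∀ s, (actions s).Nonempty
  trans : S → A → PMF S
  cost : S → ℝ≥0

/-- A policy: given the past (the list of earlier state-action pairs, most recent first) and the
current state, it draws a feasible action.  It may depend on the history and may randomize. -/
structure Policy {S A : Type} (M : MDP S A) where
  act : List (S × A) → S → PMF A
  feasible : ∀ h s, ∀ a ∈ (act h s).support, a ∈ M.actions s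

/-- A (deterministic) stationary policy: one feasible action for each state. -/
structure StationaryPolicy {S A : Type} (M : MDP S A) where
  act : S → A
  feasible : ∀ s, act s ∈ M.actions s

/-- A stationary policy, regarded as a policy. -/
noncomputable def StationaryPolicy.toPolicy {S A : Type} {M : MDP S A}
    (f : StationaryPolicy M) : Policy M where
  act := fun _ s => PMF.pure (f.act s)
  feasible := by
    intro h s a ha
    rw [PMF.mem_support_pure_iff] at ha
    rw [ha]
    exact f.feasible s

/-- The joint law of the past and of the state at time `k`, when the process starts in `s₀` and
follows the policy `φ`. -/
noncomputable def Policy.law {S A : Type} {M : MDP S A} (φ : Policy M) (s₀ : S) :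
    ℕ → PMF (List (S × A) × S)
  | 0 => PMF.pure ([], s₀)
  | k + 1 => (φ.law s₀ k).bind fun x =>
      (φ.act x.1 x.2).bind fun a =>
        (M.trans x.2 a).bind fun s => PMF.pure ((x.2, a) :: x.1, s)

/-- The expected immediate cost at time `k`. -/
noncomputable def Policy.expCost {S A : Type} {M : MDP S A} (φ : Policy M) (s₀ : S) (k : ℕ) :
    ℝ≥0∞ :=
  ∑' x : List (S × A) × S, φ.law s₀ k x * (M.cost x.2 : ℝ≥0∞)

/-- The long-run expected average cost, `limsup_K (1/K) E[∑_{k<K} C(s_k)]`. -/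
noncomputable def Policy.avgCost {S A : Type} {M : MDP S A} (φ : Policy M) (s₀ : S) : ℝ≥0∞ :=
  limsup (fun K : ℕ => (∑ k ∈ Finset.range K, φ.expCost s₀ k) / (K : ℝ≥0∞)) atTop

/-- A policy is optimal if, from every starting state, its average cost is minimal among all
policies. -/
def Policy.IsOptimal {S A : Type} {M : MDP S A} (φ : Policy M) : Prop :=
  ∀ (s₀ : S) (χ : Policy M), φ.avgCost s₀ ≤ χ.avgCost s₀

/-- Optimality of a stationary policy (among all policies). -/
def StationaryPolicy.IsOptimal {S A : Type} {M : MDP S A} (f : StationaryPolicy M) : Prop :=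
  f.toPolicy.IsOptimal

/-! ### Relative value iteration (used for finite state spaces) -/

/-- `H_{s,a} = C(s) + ∑_{s'} P_{s,s'}(a) V(s')`. -/
noncomputable def MDP.qValue {S A : Type} (M : MDP S A) (V : S → ℝ) (s : S) (a : A) : ℝ :=
  (M.cost s : ℝ) + ∑' s' : S, (M.trans s a s').toReal * V s'

/-- `Q(s) = min_a H_{s,a}`, the minimum being over the feasible actions. -/
noncomputable def MDP.bellman {S A : Type} (M : MDP S A) (V : S → ℝ) (s : S) : ℝ :=
  (M.actions s).inf' (M.actions_nonempty s) (M.qValue V s)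

/-- The iterates of relative value iteration with reference state `ref`:
`V_0 = 0` and `V_{ν+1}(s) = Q_{ν+1}(s) - Q_{ν+1}(ref)`. -/
noncomputable def MDP.rvi {S A : Type} (M : MDP S A) (ref : S) : ℕ → S → ℝ
  | 0 => fun _ => 0
  | ν + 1 => fun s => M.bellman (M.rvi ref ν) s - M.bellman (M.rvi ref ν) ref

/-- Relative value iteration with reference state `ref` and tolerance `ε` halts and may return the
stationary policy `f`: it performs sweeps until, for the first time, two consecutive iterates differ
by at most `ε` in every state, and returns a minimizer of `H_{s,a}` as computed in the last sweep
(ties are broken in an arbitrary way). -/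
def MDP.RVIReturns {S A : Type} (M : MDP S A) (ref : S) (ε : ℝ) (f : StationaryPolicy M) : Prop :=
  ∃ ν : ℕ, IsLeast {n : ℕ | ∀ s, |M.rvi ref (n + 1) s - M.rvi ref n s| ≤ ε} ν ∧
    ∀ s, ∀ a ∈ M.actions s, M.qValue (M.rvi ref ν) s (f.act s) ≤ M.qValue (M.rvi ref ν) s a

/-! ### The system: a symmetric binary source, a channel with random delay -/

/-- The parameters: the flip probability `p` of the source, the law `T` of the transmission time
(on the positive integers), and the maximal number `tmax` of slots that a transmission may last. -/
structure Params where
  p : ℝ≥0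
  p_pos : 0 < p
  p_le_half : p ≤ 1 / 2
  T : PMF ℕ
  T_zero : T 0 = 0
  tmax : ℕ
  one_lt_tmax : 1 < tmax

/-- The state of the channel.  `idle` is `(t, i) = (0, -1)`.  `busy t _ _ d` means that the current
transmission has been in progress for `t` slots; `d = false` (`i = 0`) if the update being
transmitted equals the receiver's estimate and `d = true` (`i = 1`) if it differs from it. -/
inductive Channel (tmax : ℕ) : Type
  | idle : Channel tmax
  | busy (t : ℕ) (pos : 0 < t) (lt : t < tmax) (differs : Bool) : Channel tmax

/-- The state `(Δ, t, i)` of the system: the age of incorrect information `Δ = age` and the state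
`(t, i)` of the channel. -/
structure State (tmax : ℕ) where
  age : ℕ
  channel : Channel tmax

/-- A coin that shows `true` with probability `r`. -/
noncomputable def coin (r : ℝ≥0∞) (hr : r ≤ 1) : PMF Bool :=
  PMF.ofFintype (fun b => cond b r (1 - r)) (by simp [hr])

/-- `Pr(T > t)`, that is, `1 - ∑_{k=1}^t p_k`. -/
noncomputable def Params.tail (c : Params) (t : ℕ) : ℝ≥0∞ :=
  1 - ∑ k ∈ Finset.Icc 1 t, c.T k

theorem Params.tail_anti (c : Params) (t : ℕ) : c.tail (t + 1) ≤ c.tail t :=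
  tsub_le_tsub_left
    (Finset.sum_le_sum_of_subset (Finset.Icc_subset_Icc_right (Nat.le_succ t))) 1

/-- `Pr(T > t + 1 ∣ T > t)`.  (By convention this is `0` if `Pr(T > t) = 0`; a transmission is then
never in progress for `t` slots.) -/
noncomputable def Params.stay (c : Params) (t : ℕ) : ℝ≥0∞ :=
  c.tail (t + 1) / c.tail t

theorem Params.stay_le_one (c : Params) (t : ℕ) : c.stay t ≤ 1 :=
  ENNReal.div_le_of_le_mul (by simpa using c.tail_anti t)

theorem Params.p_le_one (c : Params) : (c.p : ℝ≥0∞) ≤ 1 := by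
  exact_mod_cast c.p_le_half.trans (by norm_num)

/-- The evolution of the age: the estimate is wrong in the next slot iff an odd number of the
following hold: it is wrong now; the source flips; the receiver's estimate changes. -/
def nextAge (Δ : ℕ) (flip estChange : Bool) : ℕ :=
  if xor (decide (0 < Δ)) (xor flip estChange) then Δ + 1 else 0

/-- The channel after a slot at whose end a transmission has been in progress for `t > 0` slots and
has not been delivered: the update is discarded if `t = tmax`. -/
def afterSlot (tmax t : ℕ) (pos : 0 < t) (differs : Bool) : Channel tmax :=
  if h : t < tmax then Channel.busy t pos h differs else Channel.idle

/-- One slot during which an update is being transmitted.  At its beginning the age is `Δ`, the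
transmission has already been in progress for `t` slots and `differs` tells whether the update
differs from the receiver's estimate.  The source flips with probability `p`; independently, the
update remains undelivered with probability `Pr(T > t + 1 ∣ T > t)`.  Upon delivery the estimate
becomes the update and the channel becomes idle. -/
noncomputable def Params.transmitSlot (c : Params) (Δ t : ℕ) (differs : Bool) :
    PMF (State c.tmax) :=
  (coin c.p c.p_le_one).bind fun flip =>
    (coin (c.stay t) (c.stay_le_one t)).bind fun undelivered =>
      PMF.pure
        (if undelivered then
          ⟨nextAge Δ flip false, afterSlot c.tmax (t + 1) (Nat.succ_pos t) differs⟩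
        else ⟨nextAge Δ flip differs, Channel.idle⟩)

/-- One slot during which nothing is transmitted. -/
noncomputable def Params.idleSlot (c : Params) (Δ : ℕ) : PMF (State c.tmax) :=
  (coin c.p c.p_le_one).bind fun flip => PMF.pure ⟨nextAge Δ flip false, Channel.idle⟩

/-- The feasible actions (`true`: start a transmission): no choice while the channel is busy. -/
def feasibleActions {tmax : ℕ} (s : State tmax) : Finset Bool :=
  match s.channel with
  | Channel.idle => {false, true}
  | Channel.busy _ _ _ _ => {false}

theorem feasibleActions_nonempty {tmax : ℕ} (s : State tmax) : (feasibleActions s).Nonempty := by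
  unfold feasibleActions
  split <;> simp

/-- The transition probabilities.  An update sampled at age `Δ` differs from the receiver's current
estimate iff `Δ > 0`. -/
noncomputable def Params.step (c : Params) (s : State c.tmax) (a : Bool) : PMF (State c.tmax) :=
  match s.channel with
  | Channel.idle =>
      if a then c.transmitSlot s.age 0 (decide (0 < s.age)) else c.idleSlot s.age
  | Channel.busy t _ _ differs => c.transmitSlot s.age t differs

/-- The decision process `𝓜`: the immediate cost is the age of incorrect information. -/
noncomputable def Params.mdp (c : Params) : MDP (State c.tmax) Bool where
  actions := feasibleActions
  actions_nonempty := feasibleActions_nonempty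
  trans := c.step
  cost := fun s => (s.age : ℝ≥0)

/-- The truncated state space: the states with `Δ ≤ m`. -/
abbrev TruncState (tmax m : ℕ) : Type := {s : State tmax // s.age ≤ m}

/-- A state with `Δ > m` is redirected to the state with `Δ = m` and the same `(t, i)`. -/
def redirect {tmax : ℕ} (m : ℕ) (s : State tmax) : TruncState tmax m :=
  ⟨⟨min s.age m, s.channel⟩, min_le_right _ _⟩

/-- The truncated decision process `𝓜^(m)`. -/
noncomputable def Params.truncMDP (c : Params) (m : ℕ) : MDP (TruncState c.tmax m) Bool where
  actions := fun s => feasibleActions s.1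
  actions_nonempty := fun s => feasibleActions_nonempty s.1
  trans := fun s a => (c.step s.1 a).map (redirect m)
  cost := fun s => (s.1.age : ℝ≥0)

/-- The stationary policy `f` of `𝓜^(m)` and the stationary policy `φ` of `𝓜` take the same action
in the state `s`, which belongs to both state spaces. -/
def AgreeAt {c : Params} {m : ℕ} (f : StationaryPolicy (c.truncMDP m))
    (φ : StationaryPolicy c.mdp) (s : State c.tmax) : Prop :=
  ∃ h : s.age ≤ m, f.act ⟨s, h⟩ = φ.act s

/-- `φ` is a limit point of the sequence `f m` of stationary policies of `𝓜^(m)`: along some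
subsequence, the action in each state is eventually that of `φ`. -/
def IsLimitPoint {c : Params} (f : ∀ m, StationaryPolicy (c.truncMDP m))
    (φ : StationaryPolicy c.mdp) : Prop :=
  ∃ n : ℕ → ℕ, StrictMono n ∧ ∀ s, ∀ᶠ k in atTop, AgreeAt (f (n k)) φ s

end AoII

/-! Everything rests on one Lyapunov function `Params.lyapunov`, written $W$ here, which serves
$\mathcal M$ and all its truncations, under all actions, with the same constants. Since $p\le 1/2$,
whatever becomes of the estimate, the next age is $0$ with probability at least $p$; and a
transmission ends within $t_{max}$ slots. So the state `base` (age $0$, idle channel) is reached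
from everywhere at an expected cost bounded by $W$.

The drift inequality keeps $\mathbb E\,W(s_k)$ bounded along every policy. By telescoping, a
function $h=O(W)$ with $g+h\le C+P_a h$ for all feasible $a$ bounds every average cost below by $g$
(`Drift.le_avgCost`), and the reverse inequality along a policy bounds its cost above
(`Drift.avgCost_le`). Each stationary policy has a solution of its evaluation equation, bounded by a
multiple of $W$ (`Drift.exists_evaluation`).

For a truncated process, the obstacle to convergence of value iteration is periodicity. It
disappears because an update equal to the estimate is worthless (`IdleLE`): a greedy choice in
`base` is to idle. Under such choices `base` is occupied $t_{max}$ slots later with probability at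
least $p^{t_{max}}$, so the span of the increments contracts by $1-p^{t_{max}}$
(`Params.increment_contract`). Hence relative value iteration halts with a $2\epsilon$-optimal
policy. As there are finitely many stationary policies, one is optimal, and small tolerances leave
no suboptimal output (`Drift.exists_isOptimal`).

For the limit $m\to\infty$, `Params.exists_approx` attaches to an optimal policy of $\mathcal
M^{(m)}$ two functions bounded by a multiple of $W$ independent of $m$: an approximate subsolution
of the optimality equation and a solution of the policy's own evaluation equation. Both are needed,
since an average-optimal policy need not be greedy in transient states. Transitions have finite
support, so both relations survive pointwise limits: the first bounds all policies of $\mathcal M$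
from below, the second shows that the limit policy attains the bound (`Params.isOptimal_of_limit`).
Limit points exist because $\{0,1\}^{\mathcal S}$ is compact. -/

namespace AoII

/-! ### Expectations with respect to finitely supported laws -/

/-- The expectation of a real function. -/
noncomputable def expect {α : Type} (μ : PMF α) (V : α → ℝ) : ℝ := ∑' s, (μ s).toReal * V s

section Expect

variable {α β : Type} {μ : PMF α}

theorem expect_eq_sum (V : α → ℝ) {t : Finset α} (h : μ.support ⊆ t) :
    expect μ V = ∑ s ∈ t, (μ s).toReal * V s := by
  refine tsum_eq_sum fun s hs => ?_
  have : μ s = 0 := by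
    by_contra h0
    exact hs (h ((μ.mem_support_iff s).2 h0))
  simp [this]

theorem sum_toReal_eq_one {t : Finset α} (h : μ.support ⊆ t) : ∑ s ∈ t, (μ s).toReal = 1 := by
  have h1 : ∑ s ∈ t, μ s = 1 := by
    rw [← μ.tsum_coe]
    refine (tsum_eq_sum fun s hs => ?_).symm
    by_contra h0
    exact hs (h ((μ.mem_support_iff s).2 h0))
  rw [← ENNReal.toReal_sum fun s _ => μ.apply_ne_top s, h1, ENNReal.toReal_one]

variable (hμ : μ.support.Finite)
include hμ

theorem expect_const (r : ℝ) : expect μ (fun _ => r) = r := by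
  rw [expect_eq_sum _ hμ.coe_toFinset.ge, ← Finset.sum_mul, sum_toReal_eq_one hμ.coe_toFinset.ge,
    one_mul]

theorem expect_add (V U : α → ℝ) : expect μ (fun s => V s + U s) = expect μ V + expect μ U := by
  simp only [expect_eq_sum _ hμ.coe_toFinset.ge, mul_add, Finset.sum_add_distrib]

theorem expect_sub (V U : α → ℝ) : expect μ (fun s => V s - U s) = expect μ V - expect μ U := by
  simp only [expect_eq_sum _ hμ.coe_toFinset.ge, mul_sub, Finset.sum_sub_distrib]

theorem expect_mono {V U : α → ℝ} (h : ∀ s ∈ μ.support, V s ≤ U s) :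
    expect μ V ≤ expect μ U := by
  simp only [expect_eq_sum _ hμ.coe_toFinset.ge]
  refine Finset.sum_le_sum fun s hs => ?_
  exact mul_le_mul_of_nonneg_left (h s (hμ.mem_toFinset.1 hs)) ENNReal.toReal_nonneg

theorem abs_expect_le (V : α → ℝ) : |expect μ V| ≤ expect μ fun s => |V s| := by
  simp only [expect_eq_sum _ hμ.coe_toFinset.ge]
  refine (Finset.abs_sum_le_sum_abs _ _).trans (Finset.sum_le_sum fun s _ => ?_)
  rw [abs_mul, abs_of_nonneg ENNReal.toReal_nonneg]

theorem tendsto_expect {ι : Type} {l : Filter ι} {V : ι → α → ℝ} {U : α → ℝ}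
    (h : ∀ s, Tendsto (fun i => V i s) l (nhds (U s))) :
    Tendsto (fun i => expect μ (V i)) l (nhds (expect μ U)) := by
  simp only [expect_eq_sum _ hμ.coe_toFinset.ge]
  exact tendsto_finsetSum _ fun s _ => (h s).const_mul _

theorem support_bind_finite {κ : α → PMF β} (hκ : ∀ a ∈ μ.support, (κ a).support.Finite) :
    (μ.bind κ).support.Finite := by
  rw [PMF.support_bind]
  exact hμ.biUnion hκ

theorem expect_bind {κ : α → PMF β} (hκ : ∀ a ∈ μ.support, (κ a).support.Finite) (V : β → ℝ) :
    expect (μ.bind κ) V = expect μ fun a => expect (κ a) V := by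
  have hb := support_bind_finite hμ hκ
  have hsub : ∀ a ∈ hμ.toFinset, (κ a).support ⊆ hb.toFinset := by
    intro a ha
    rw [hb.coe_toFinset, PMF.support_bind]
    exact Set.subset_biUnion_of_mem (u := fun a => (κ a).support) (hμ.mem_toFinset.1 ha)
  rw [expect_eq_sum _ hb.coe_toFinset.ge, expect_eq_sum _ hμ.coe_toFinset.ge]
  have h1 : ∀ b, ((μ.bind κ) b).toReal = ∑ a ∈ hμ.toFinset, (μ a).toReal * (κ a b).toReal := by
    intro b
    rw [PMF.bind_apply, tsum_eq_sum (s := hμ.toFinset), ENNReal.toReal_sum]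
    · simp only [ENNReal.toReal_mul]
    · exact fun a _ => ENNReal.mul_ne_top (μ.apply_ne_top a) ((κ a).apply_ne_top b)
    · intro a ha
      have : μ a = 0 := by
        by_contra h0
        exact ha (hμ.mem_toFinset.2 ((μ.mem_support_iff a).2 h0))
      simp [this]
  simp only [h1, Finset.sum_mul]
  rw [Finset.sum_comm]
  refine Finset.sum_congr rfl fun a ha => ?_
  rw [expect_eq_sum _ (hsub a ha), Finset.mul_sum]
  exact Finset.sum_congr rfl fun b _ => by ring

omit hμ in
theorem expect_const_mul (r : ℝ) (V : α → ℝ) : expect μ (fun s => r * V s) = r * expect μ V := by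
  unfold expect
  rw [← tsum_mul_left]
  exact tsum_congr fun s => by ring

omit hμ in
theorem expect_pure (a : α) (V : α → ℝ) : expect (PMF.pure a) V = V a := by
  rw [expect_eq_sum (t := {a}) V (by simp)]
  simp

omit hμ in
theorem support_pure_finite (a : α) : (PMF.pure a).support.Finite := by
  rw [PMF.support_pure]
  exact Set.finite_singleton a

theorem support_map_finite (f : α → β) : (μ.map f).support.Finite := by
  rw [PMF.support_map]
  exact hμ.image f

theorem expect_map (f : α → β) (V : β → ℝ) : expect (μ.map f) V = expect μ fun s => V (f s) := by
  rw [← PMF.bind_pure_comp, expect_bind (κ := PMF.pure ∘ f) hμ fun a _ => support_pure_finite _]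
  simp only [Function.comp, expect_pure]

end Expect

/-! ### Decision processes with a Lyapunov function -/

/-- Whatever the actions, `W` bounds the expected sum of `1 + cost` until the next visit to `z`,
and `W` grows at most as fast as the cost. -/
structure Drift {S A : Type} (M : MDP S A) (z : S) (W : S → ℝ) (B : ℝ) : Prop where
  finite : ∀ s a, (M.trans s a).support.Finite
  nonneg : ∀ s, 0 ≤ W s
  drift : ∀ s a, 1 + M.cost s + expect (M.trans s a) (Set.indicator {z}ᶜ W) ≤ W s
  le_mul : ∀ s, W s ≤ B * (1 + M.cost s)

section Abstract

variable {S A : Type} {M : MDP S A} {z : S} {W : S → ℝ} {B : ℝ}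

theorem expect_nonneg {α : Type} (μ : PMF α) {V : α → ℝ} (h : ∀ s, 0 ≤ V s) : 0 ≤ expect μ V :=
  tsum_nonneg fun s => mul_nonneg ENNReal.toReal_nonneg (h s)

namespace Drift

theorem indicator_nonneg (d : Drift M z W B) (s : S) : 0 ≤ Set.indicator {z}ᶜ W s :=
  Set.indicator_nonneg (fun s _ => d.nonneg s) s

theorem one_add_cost_le (d : Drift M z W B) (s : S) : 1 + (M.cost s : ℝ) ≤ W s := by
  obtain ⟨a, -⟩ := M.actions_nonempty s
  have := expect_nonneg (M.trans s a) d.indicator_nonneg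
  linarith [d.drift s a]

theorem one_le (d : Drift M z W B) (s : S) : 1 ≤ W s := by
  linarith [d.one_add_cost_le s, (M.cost s).coe_nonneg]

theorem one_le_const (d : Drift M z W B) : 1 ≤ B := by
  have h := (d.one_add_cost_le z).trans (d.le_mul z)
  have h0 : (0 : ℝ) < 1 + M.cost z := by linarith [(M.cost z).coe_nonneg]
  exact le_of_mul_le_mul_right (by linarith) h0

theorem div_le (d : Drift M z W B) (s : S) : W s / B ≤ 1 + M.cost s := by
  rw [div_le_iff₀ (by linarith [d.one_le_const])]
  linarith [d.le_mul s]

theorem expect_le (d : Drift M z W B) (s : S) (a : A) :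
    expect (M.trans s a) W ≤ W s - W s / B + W z := by
  have h : expect (M.trans s a) W ≤ expect (M.trans s a) (fun t => Set.indicator {z}ᶜ W t + W z) :=
    expect_mono (d.finite s a) fun t _ => by
      by_cases ht : t = z
      · simp [ht]
      · simp [ht, d.nonneg z]
  rw [expect_add (d.finite s a), expect_const (d.finite s a)] at h
  linarith [d.drift s a, d.div_le s]

end Drift

/-! ### The process under a policy -/

/-- The expectation of a function of the state at time `k`. -/
noncomputable def Policy.expectAt (φ : Policy M) (s₀ : S) (k : ℕ) (V : S → ℝ) : ℝ :=
  expect (φ.law s₀ k) fun x => V x.2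

theorem Policy.support_act_finite (φ : Policy M) (l : List (S × A)) (s : S) :
    (φ.act l s).support.Finite :=
  (M.actions s).finite_toSet.subset fun a ha => φ.feasible l s a ha

theorem Policy.support_law_finite (hM : ∀ s a, (M.trans s a).support.Finite) (φ : Policy M)
    (s₀ : S) (k : ℕ) : (φ.law s₀ k).support.Finite := by
  induction k with
  | zero => exact support_pure_finite _
  | succ k ih =>
    exact support_bind_finite ih fun x _ => support_bind_finite (φ.support_act_finite _ _)
      fun a _ => support_bind_finite (hM _ _) fun s _ => support_pure_finite _

theorem Policy.expectAt_zero (φ : Policy M) (s₀ : S) (V : S → ℝ) : φ.expectAt s₀ 0 V = V s₀ :=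
  expect_pure _ _

theorem Policy.expectAt_succ (hM : ∀ s a, (M.trans s a).support.Finite) (φ : Policy M)
    (s₀ : S) (k : ℕ) (V : S → ℝ) :
    φ.expectAt s₀ (k + 1) V = expect (φ.law s₀ k) fun x =>
      expect (φ.act x.1 x.2) fun a => expect (M.trans x.2 a) V := by
  have h3 : ∀ x : List (S × A) × S, ∀ a, ((M.trans x.2 a).bind fun s =>
      PMF.pure ((x.2, a) :: x.1, s)).support.Finite := fun x a =>
    support_bind_finite (hM _ _) fun s _ => support_pure_finite _
  unfold Policy.expectAt
  rw [Policy.law, expect_bind (φ.support_law_finite hM s₀ k) fun x _ =>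
    support_bind_finite (φ.support_act_finite _ _) fun a _ => h3 x a]
  refine congrArg _ (funext fun x => ?_)
  rw [expect_bind (φ.support_act_finite _ _) fun a _ => h3 x a]
  refine congrArg _ (funext fun a => ?_)
  rw [expect_bind (hM _ _) fun s _ => support_pure_finite _]
  simp only [expect_pure]

theorem Policy.expectAt_mono (hM : ∀ s a, (M.trans s a).support.Finite) (φ : Policy M)
    (s₀ : S) (k : ℕ) {V U : S → ℝ} (h : ∀ s, V s ≤ U s) :
    φ.expectAt s₀ k V ≤ φ.expectAt s₀ k U :=
  expect_mono (φ.support_law_finite hM s₀ k) fun x _ => h x.2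

/-- A one-step inequality passes to expectations along a policy. -/
theorem Policy.expectAt_le_of_step (hM : ∀ s a, (M.trans s a).support.Finite) (φ : Policy M)
    (s₀ : S) (k : ℕ) {V U : S → ℝ}
    (h : ∀ l s, ∀ a ∈ (φ.act l s).support, V s ≤ expect (M.trans s a) U) :
    φ.expectAt s₀ k V ≤ φ.expectAt s₀ (k + 1) U := by
  rw [φ.expectAt_succ hM]
  refine expect_mono (φ.support_law_finite hM s₀ k) fun x _ => ?_
  calc V x.2 = expect (φ.act x.1 x.2) fun _ => V x.2 :=
        (expect_const (φ.support_act_finite _ _) _).symm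
    _ ≤ _ := expect_mono (φ.support_act_finite _ _) fun a ha => h _ _ a ha

theorem Policy.expectAt_add (hM : ∀ s a, (M.trans s a).support.Finite) (φ : Policy M)
    (s₀ : S) (k : ℕ) (V U : S → ℝ) :
    φ.expectAt s₀ k (fun s => V s + U s) = φ.expectAt s₀ k V + φ.expectAt s₀ k U :=
  expect_add (φ.support_law_finite hM s₀ k) _ _

theorem Policy.expectAt_const (hM : ∀ s a, (M.trans s a).support.Finite) (φ : Policy M)
    (s₀ : S) (k : ℕ) (r : ℝ) : φ.expectAt s₀ k (fun _ => r) = r :=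
  expect_const (φ.support_law_finite hM s₀ k) r

theorem Policy.expectAt_const_mul (φ : Policy M) (s₀ : S) (k : ℕ) (r : ℝ) (V : S → ℝ) :
    φ.expectAt s₀ k (fun s => r * V s) = r * φ.expectAt s₀ k V :=
  expect_const_mul r _

/-- The recursion $x\mapsto(1-1/B)x+W(z)$ has the fixed point $B\,W(z)$. -/
theorem Drift.expectAt_le (d : Drift M z W B) (φ : Policy M) (s₀ : S) (k : ℕ) :
    φ.expectAt s₀ k W ≤ W s₀ + B * W z := by
  have hB := d.one_le_const
  induction k with
  | zero =>
    rw [φ.expectAt_zero]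
    nlinarith [d.nonneg z]
  | succ k ih =>
    have h : φ.expectAt s₀ k (fun s => -(1 - 1 / B) * W s + -W z) ≤
        φ.expectAt s₀ (k + 1) (fun s => (-1) * W s) :=
      φ.expectAt_le_of_step d.finite s₀ k fun l s a _ => by
        rw [expect_const_mul]
        have := d.expect_le s a
        have e : (1 - 1 / B) * W s = W s - W s / B := by ring
        linarith
    rw [φ.expectAt_add d.finite, φ.expectAt_const_mul, φ.expectAt_const_mul,
      φ.expectAt_const d.finite] at h
    have h1 : 0 ≤ 1 - 1 / B := by
      rw [sub_nonneg, div_le_one (by linarith)]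
      exact hB
    have h2 := mul_le_mul_of_nonneg_left ih h1
    have e : (1 - 1 / B) * (W s₀ + B * W z) = W s₀ + B * W z - W s₀ / B - W z := by
      field_simp
      ring
    have h3 : 0 ≤ W s₀ / B := div_nonneg (d.nonneg _) (by linarith)
    linarith

theorem Drift.abs_expectAt_le (d : Drift M z W B) (φ : Policy M) (s₀ : S) (k : ℕ) {h : S → ℝ}
    {c : ℝ} (hc : 0 ≤ c) (hh : ∀ s, |h s| ≤ c * W s) :
    |φ.expectAt s₀ k h| ≤ c * (W s₀ + B * W z) := by
  calc |φ.expectAt s₀ k h| ≤ φ.expectAt s₀ k fun s => |h s| :=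
        abs_expect_le (φ.support_law_finite d.finite s₀ k) _
    _ ≤ φ.expectAt s₀ k fun s => c * W s := φ.expectAt_mono d.finite s₀ k hh
    _ = c * φ.expectAt s₀ k W := φ.expectAt_const_mul ..
    _ ≤ _ := mul_le_mul_of_nonneg_left (d.expectAt_le φ s₀ k) hc

/-- The one-step inequalities telescope. `C` and `g` may have any sign, so that negating all data
gives the upper bound as well. -/
theorem Policy.sum_expectAt_ge (hM : ∀ s a, (M.trans s a).support.Finite) (φ : Policy M)
    (s₀ : S) {g : ℝ} {C h : S → ℝ}
    (H : ∀ l s, ∀ a ∈ (φ.act l s).support, g + h s ≤ C s + expect (M.trans s a) h) (K : ℕ) :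
    K * g + h s₀ ≤ ∑ k ∈ Finset.range K, φ.expectAt s₀ k C + φ.expectAt s₀ K h := by
  induction K with
  | zero => simp [φ.expectAt_zero]
  | succ K ih =>
    have h1 : φ.expectAt s₀ K (fun s => g + h s + (-1) * C s) ≤ φ.expectAt s₀ (K + 1) h :=
      φ.expectAt_le_of_step hM s₀ K fun l s a ha => by linarith [H l s a ha]
    rw [φ.expectAt_add hM, φ.expectAt_add hM, φ.expectAt_const_mul, φ.expectAt_const hM] at h1
    rw [Finset.sum_range_succ]
    push_cast
    linarith

theorem Policy.expCost_eq (hM : ∀ s a, (M.trans s a).support.Finite) (φ : Policy M) (s₀ : S)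
    (k : ℕ) : φ.expCost s₀ k = ENNReal.ofReal (φ.expectAt s₀ k fun s => M.cost s) := by
  have hf := φ.support_law_finite hM s₀ k
  unfold Policy.expCost Policy.expectAt
  rw [expect_eq_sum _ hf.coe_toFinset.ge, tsum_eq_sum (s := hf.toFinset),
    ENNReal.ofReal_sum_of_nonneg]
  · refine Finset.sum_congr rfl fun x _ => ?_
    rw [ENNReal.ofReal_mul ENNReal.toReal_nonneg,
      ENNReal.ofReal_toReal ((φ.law s₀ k).apply_ne_top x), ENNReal.ofReal_coe_nnreal]
  · exact fun x _ => mul_nonneg ENNReal.toReal_nonneg (NNReal.coe_nonneg _)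
  · intro x hx
    have : φ.law s₀ k x = 0 := by
      by_contra h0
      exact hx (hf.mem_toFinset.2 ((PMF.mem_support_iff _ x).2 h0))
    simp [this]

theorem Policy.avgCost_eq (hM : ∀ s a, (M.trans s a).support.Finite) (φ : Policy M) (s₀ : S) :
    φ.avgCost s₀ = limsup (fun K : ℕ => ENNReal.ofReal
      ((∑ k ∈ Finset.range K, φ.expectAt s₀ k fun s => M.cost s) / K)) atTop := by
  refine limsup_congr ((eventually_gt_atTop 0).mono fun K hK => ?_)
  simp only [φ.expCost_eq hM]
  rw [ENNReal.ofReal_div_of_pos (by exact_mod_cast hK), ENNReal.ofReal_sum_of_nonneg,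
    ENNReal.ofReal_natCast]
  exact fun k _ => expect_nonneg _ fun x => NNReal.coe_nonneg _

theorem tendsto_ofReal_add_div (g r : ℝ) :
    Tendsto (fun K : ℕ => ENNReal.ofReal (g + r / K)) atTop (nhds (ENNReal.ofReal g)) := by
  refine ENNReal.tendsto_ofReal ?_
  simpa using (tendsto_const_div_atTop_nhds_zero_nat r).const_add g

/-- A subsolution of the optimality equation bounds the average cost from below. -/
theorem Drift.le_avgCost (d : Drift M z W B) (φ : Policy M) (s₀ : S) {g c : ℝ} {h : S → ℝ}
    (hc : 0 ≤ c) (hh : ∀ s, |h s| ≤ c * W s)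
    (H : ∀ l s, ∀ a ∈ (φ.act l s).support, g + h s ≤ M.cost s + expect (M.trans s a) h) :
    ENNReal.ofReal g ≤ φ.avgCost s₀ := by
  rw [φ.avgCost_eq d.finite,
    ← (tendsto_ofReal_add_div g (h s₀ - c * (W s₀ + B * W z))).limsup_eq]
  refine limsup_le_limsup ((eventually_gt_atTop 0).mono fun K hK => ?_)
  have hK' : (0 : ℝ) < K := by exact_mod_cast hK
  refine ENNReal.ofReal_le_ofReal ?_
  rw [le_div_iff₀ hK', add_mul, div_mul_cancel₀ _ hK'.ne']
  have h1 := φ.sum_expectAt_ge d.finite s₀ H K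
  have h2 := (abs_le.1 (d.abs_expectAt_le φ s₀ K hc hh)).2
  linarith

/-- A supersolution of the evaluation equation bounds the average cost from above. -/
theorem Drift.avgCost_le (d : Drift M z W B) (φ : Policy M) (s₀ : S) {g c : ℝ} {h : S → ℝ}
    (hc : 0 ≤ c) (hh : ∀ s, |h s| ≤ c * W s)
    (H : ∀ l s, ∀ a ∈ (φ.act l s).support, M.cost s + expect (M.trans s a) h ≤ g + h s) :
    φ.avgCost s₀ ≤ ENNReal.ofReal g := by
  rw [φ.avgCost_eq d.finite,
    ← (tendsto_ofReal_add_div g (h s₀ + c * (W s₀ + B * W z))).limsup_eq]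
  refine limsup_le_limsup ((eventually_gt_atTop 0).mono fun K hK => ?_)
  have hK' : (0 : ℝ) < K := by exact_mod_cast hK
  refine ENNReal.ofReal_le_ofReal ?_
  rw [div_le_iff₀ hK', add_mul, div_mul_cancel₀ _ hK'.ne']
  have h1 := φ.sum_expectAt_ge (g := -g) (h := fun s => (-1) * h s)
    (C := fun s => (-1) * (M.cost s : ℝ)) d.finite s₀
    (fun l s a ha => by rw [expect_const_mul]; linarith [H l s a ha]) K
  simp only [φ.expectAt_const_mul, ← Finset.mul_sum] at h1
  have h2 := (abs_le.1 (d.abs_expectAt_le φ s₀ K hc hh)).1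
  linarith

/-- The average cost of a stationary policy, from a solution of its evaluation equation. -/
theorem Drift.avgCost_eq (d : Drift M z W B) (f : StationaryPolicy M) (s₀ : S) {g c : ℝ}
    {h : S → ℝ} (hc : 0 ≤ c) (hh : ∀ s, |h s| ≤ c * W s)
    (H : ∀ s, g + h s = M.cost s + expect (M.trans s (f.act s)) h) :
    f.toPolicy.avgCost s₀ = ENNReal.ofReal g := by
  have key : ∀ (l : List (S × A)) (s : S), ∀ a ∈ (f.toPolicy.act l s).support, a = f.act s :=
    fun l s a ha => (PMF.mem_support_pure_iff _ _).1 ha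
  refine le_antisymm (d.avgCost_le _ s₀ hc hh fun l s a ha => ?_)
    (d.le_avgCost _ s₀ hc hh fun l s a ha => ?_)
  · rw [key l s a ha, H s]
  · rw [key l s a ha, H s]

/-! ### The evaluation equation of a stationary policy -/

/-- The expected sum of `c ≤ 1 + cost` until the next visit to `z`. -/
theorem Drift.exists_sum_until (d : Drift M z W B) (f : StationaryPolicy M) {c : S → ℝ}
    (hc0 : ∀ s, 0 ≤ c s) (hc : ∀ s, c s ≤ 1 + M.cost s) :
    ∃ V : S → ℝ, (∀ s, c s ≤ V s) ∧ (∀ s, V s ≤ W s) ∧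
      ∀ s, V s = c s + expect (M.trans s (f.act s)) (Set.indicator {z}ᶜ V) := by
  let T : (S → ℝ) → S → ℝ := fun V s => c s + expect (M.trans s (f.act s)) (Set.indicator {z}ᶜ V)
  have hT : ∀ V U : S → ℝ, (∀ s, V s ≤ U s) → ∀ s, T V s ≤ T U s := fun V U h s =>
    add_le_add_right (expect_mono (d.finite _ _) fun t _ => Set.indicator_le_indicator (h t)) _
  -- The solution is the limit of the monotone iteration from `0`; the drift inequality makes `W` a
  -- supersolution, hence an upper bound for all iterates.
  let X : ℕ → S → ℝ := fun n => T^[n] 0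
  have hX : ∀ n, X (n + 1) = T (X n) := fun n => Function.iterate_succ_apply' T n 0
  have hmono : ∀ n s, X n s ≤ X (n + 1) s := by
    intro n
    induction n with
    | zero =>
      intro s
      rw [hX]
      change (0 : ℝ) ≤ c s + expect _ (Set.indicator {z}ᶜ fun _ => (0 : ℝ))
      rw [Set.indicator_zero, expect_const (d.finite _ _), add_zero]
      exact hc0 s
    | succ n ih =>
      intro s
      rw [hX (n + 1), hX n]
      exact hT _ _ (fun t => (ih t).trans_eq (by rw [hX])) s
  have hle : ∀ n s, X n s ≤ W s := by
    intro n
    induction n with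
    | zero => exact fun s => d.nonneg s
    | succ n ih =>
      intro s
      rw [hX]
      exact (hT _ _ ih s).trans ((add_le_add_left (hc s) _).trans (d.drift s _))
  have hlim : ∀ s, Tendsto (fun n => X n s) atTop (nhds (⨆ n, X n s)) := fun s =>
    tendsto_atTop_ciSup (monotone_nat_of_le_succ fun n => hmono n s)
      ⟨W s, by rintro _ ⟨n, rfl⟩; exact hle n s⟩
  have hfix : ∀ s, (⨆ n, X n s) = T (fun s => ⨆ n, X n s) s := by
    intro s
    refine tendsto_nhds_unique ((tendsto_add_atTop_iff_nat 1).2 (hlim s)) ?_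
    simp only [hX]
    refine (tendsto_expect (d.finite _ _) fun t => ?_).const_add _
    by_cases ht : t = z
    · simp [ht]
    · simpa [ht] using hlim t
  have h0 : ∀ s, 0 ≤ ⨆ n, X n s := fun s => ge_of_tendsto' (hlim s) fun n =>
    monotone_nat_of_le_succ (fun n => hmono n s) n.zero_le
  refine ⟨fun s => ⨆ n, X n s, fun s => ?_, fun s => le_of_tendsto' (hlim s) fun n => hle n s,
    hfix⟩
  refine le_of_le_of_eq ?_ (hfix s).symm
  exact le_add_of_nonneg_right
    (expect_nonneg _ fun t => Set.indicator_nonneg (fun t _ => h0 t) t)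

/-- Renewal-reward: the average cost is the expected cost `V z` of a cycle from `z` to `z` divided
by its expected length `U z`. -/
theorem Drift.exists_evaluation (d : Drift M z W B) (f : StationaryPolicy M) :
    ∃ (g : ℝ) (h : S → ℝ), 0 ≤ g ∧ g ≤ W z ∧ (∀ s, |h s| ≤ (1 + W z) * W s) ∧
      ∀ s, g + h s = M.cost s + expect (M.trans s (f.act s)) h := by
  obtain ⟨V, hV0, hVW, hV⟩ := d.exists_sum_until f (c := fun s => (M.cost s : ℝ))
    (fun s => NNReal.coe_nonneg _) (fun s => by linarith)
  obtain ⟨U, hU0, hUW, hU⟩ := d.exists_sum_until f (c := fun _ => 1)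
    (fun s => zero_le_one) (fun s => by linarith [(M.cost s).coe_nonneg])
  have hV0' : ∀ s, 0 ≤ V s := fun s => (NNReal.coe_nonneg _).trans (hV0 s)
  have hUz : 0 < U z := zero_lt_one.trans_le (hU0 z)
  have hg0 : 0 ≤ V z / U z := div_nonneg (hV0' z) hUz.le
  have hg1 : V z / U z ≤ W z := by
    rw [div_le_iff₀ hUz]
    nlinarith [hVW z, hU0 z, d.nonneg z]
  -- This choice of `h` vanishes at `z`, so the indicators that stop the sums at `z` can be dropped.
  refine ⟨V z / U z, fun s => V s - V z / U z * U s, hg0, hg1, fun s => ?_, fun s => ?_⟩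
  · have h1 : 0 ≤ V z / U z * U s := mul_nonneg hg0 (zero_le_one.trans (hU0 s))
    have h2 : V z / U z * U s ≤ W z * W s :=
      mul_le_mul hg1 (hUW s) (zero_le_one.trans (hU0 s)) (d.nonneg z)
    rw [abs_le]
    constructor <;> nlinarith [hV0' s, hVW s, d.nonneg s]
  · have key : expect (M.trans s (f.act s)) (fun t => V t - V z / U z * U t) =
        expect (M.trans s (f.act s)) (Set.indicator {z}ᶜ V) -
          V z / U z * expect (M.trans s (f.act s)) (Set.indicator {z}ᶜ U) := by
      rw [← expect_const_mul, ← expect_sub (d.finite _ _)]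
      refine congrArg _ (funext fun t => ?_)
      by_cases ht : t = z
      · simp [ht, hUz.ne']
      · simp [ht]
    rw [key]
    have h1 := hV s
    have h2 := hU s
    have h3 : V z / U z * U s = V z / U z +
        V z / U z * expect (M.trans s (f.act s)) (Set.indicator {z}ᶜ U) := by
      conv_lhs => rw [h2]
      ring
    linarith

/-- An a priori bound for solutions of one-step inequalities that vanish at `z`. -/
theorem Drift.abs_le_of_step (d : Drift M z W B) {X : S → ℝ} {c K : ℝ} (hz : X z = 0)
    (hK : ∀ s, |X s| ≤ K * W s)
    (H : ∀ s, ∃ a, |X s| ≤ c * (1 + M.cost s) + expect (M.trans s a) fun t => |X t|) (s : S) :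
    |X s| ≤ c * W s := by
  have hB := d.one_le_const
  have hr0 : 0 ≤ 1 - 1 / B := by
    rw [sub_nonneg, div_le_one (by linarith)]
    exact hB
  have hr1 : 1 - 1 / B < 1 := sub_lt_self _ (by positivity)
  -- An excess `e` over the constant `c` shrinks by the factor `1 - 1 / B`, since the drift gains `e
  -- * (1 + cost)`, which is at least `e * W / B`. Iterating removes the dependence on `K`.
  have step : ∀ e, 0 ≤ e → (∀ s, |X s| ≤ (c + e) * W s) →
      ∀ s, |X s| ≤ (c + (1 - 1 / B) * e) * W s := by
    intro e he h s
    obtain ⟨a, ha⟩ := H s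
    have h1 : expect (M.trans s a) (fun t => |X t|) ≤
        expect (M.trans s a) (fun t => (c + e) * Set.indicator {z}ᶜ W t) :=
      expect_mono (d.finite _ _) fun t _ => by
        by_cases ht : t = z
        · simp [ht, hz]
        · simpa [ht] using h t
    rw [expect_const_mul] at h1
    have hce : 0 ≤ c + e :=
      nonneg_of_mul_nonneg_left ((abs_nonneg _).trans (h s)) (by linarith [d.one_le s])
    have h2 := mul_le_mul_of_nonneg_left (d.drift s a) hce
    have h3 := mul_le_mul_of_nonneg_left (d.div_le s) he
    have e1 : (c + (1 - 1 / B) * e) * W s = (c + e) * W s - e * (W s / B) := by ring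
    nlinarith
  have hn : ∀ n : ℕ, ∀ s, |X s| ≤ (c + (1 - 1 / B) ^ n * |K - c|) * W s := by
    intro n
    induction n with
    | zero =>
      intro s
      refine (hK s).trans (mul_le_mul_of_nonneg_right ?_ (d.nonneg s))
      linarith [le_abs_self (K - c)]
    | succ n ih =>
      intro s
      refine (step _ (by positivity) ih s).trans_eq ?_
      ring
  have ht : Tendsto (fun n : ℕ => (c + (1 - 1 / B) ^ n * |K - c|) * W s) atTop
      (nhds ((c + 0 * |K - c|) * W s)) :=
    (((tendsto_pow_atTop_nhds_zero_of_lt_one hr0 hr1).mul_const _).const_add _).mul_const _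
  rw [zero_mul, add_zero] at ht
  exact ge_of_tendsto' ht fun n => hn n s

end Abstract

/-! ### One slot of the system -/

section System

theorem support_finite_of_finite {α : Type} [Finite α] (μ : PMF α) : μ.support.Finite :=
  Set.toFinite _

theorem expect_coin {r : ℝ≥0∞} (hr : r ≤ 1) (V : Bool → ℝ) :
    expect (coin r hr) V = r.toReal * V true + (1 - r.toReal) * V false := by
  rw [expect_eq_sum (t := Finset.univ) V fun _ _ => Finset.mem_coe.2 (Finset.mem_univ _),
    Fintype.sum_bool]
  simp only [coin, PMF.ofFintype_apply, cond_true, cond_false]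
  rw [ENNReal.toReal_sub_of_le hr ENNReal.one_ne_top, ENNReal.toReal_one]

variable (c : Params)

theorem Params.p_pos_real : (0 : ℝ) < c.p := by exact_mod_cast c.p_pos

theorem Params.two_mul_p_le_one : 2 * (c.p : ℝ) ≤ 1 := by
  have h : (c.p : ℝ) ≤ ((1 / 2 : ℝ≥0) : ℝ) := by exact_mod_cast c.p_le_half
  push_cast at h
  linarith

theorem Params.stay_toReal_le_one (t : ℕ) : (c.stay t).toReal ≤ 1 := by
  simpa using ENNReal.toReal_mono ENNReal.one_ne_top (c.stay_le_one t)

theorem Params.support_transmitSlot_finite (Δ t : ℕ) (d : Bool) :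
    (c.transmitSlot Δ t d).support.Finite :=
  support_bind_finite (support_finite_of_finite _) fun _ _ =>
    support_bind_finite (support_finite_of_finite _) fun _ _ => support_pure_finite _

theorem Params.support_idleSlot_finite (Δ : ℕ) : (c.idleSlot Δ).support.Finite :=
  support_bind_finite (support_finite_of_finite _) fun _ _ => support_pure_finite _

theorem Params.expect_idleSlot (Δ : ℕ) (V : State c.tmax → ℝ) :
    expect (c.idleSlot Δ) V = c.p * V ⟨nextAge Δ true false, .idle⟩ +
      (1 - c.p) * V ⟨nextAge Δ false false, .idle⟩ := by
  rw [Params.idleSlot, expect_bind (support_finite_of_finite _) fun _ _ => support_pure_finite _,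
    expect_coin]
  simp only [expect_pure, ENNReal.coe_toReal]

theorem Params.expect_transmitSlot (Δ t : ℕ) (d : Bool) (V : State c.tmax → ℝ) :
    expect (c.transmitSlot Δ t d) V =
      c.p * ((c.stay t).toReal *
          V ⟨nextAge Δ true false, afterSlot c.tmax (t + 1) t.succ_pos d⟩ +
        (1 - (c.stay t).toReal) * V ⟨nextAge Δ true d, .idle⟩) +
      (1 - c.p) * ((c.stay t).toReal *
          V ⟨nextAge Δ false false, afterSlot c.tmax (t + 1) t.succ_pos d⟩ +
        (1 - (c.stay t).toReal) * V ⟨nextAge Δ false d, .idle⟩) := by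
  have h : ∀ flip : Bool, ((coin (c.stay t) (c.stay_le_one t)).bind fun undelivered => PMF.pure
      (if undelivered then
        (⟨nextAge Δ flip false, afterSlot c.tmax (t + 1) t.succ_pos d⟩ : State c.tmax)
      else ⟨nextAge Δ flip d, Channel.idle⟩)).support.Finite := fun flip =>
    support_bind_finite (support_finite_of_finite _) fun _ _ => support_pure_finite _
  rw [Params.transmitSlot, expect_bind (support_finite_of_finite _) fun flip _ => h flip]
  simp only [expect_bind (support_finite_of_finite (coin (c.stay t) (c.stay_le_one t)))
    fun _ _ => support_pure_finite _, expect_coin, expect_pure, ENNReal.coe_toReal, if_true,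
    Bool.false_eq_true, if_false]

theorem Params.support_step_finite (s : State c.tmax) (a : Bool) : (c.step s a).support.Finite := by
  unfold Params.step
  split
  · split
    · exact c.support_transmitSlot_finite ..
    · exact c.support_idleSlot_finite ..
  · exact c.support_transmitSlot_finite ..

/-! ### Ages and remaining transmission times after one slot -/

/-- The number of slots for which a transmission in progress may last yet. -/
def Channel.remaining {tmax : ℕ} : Channel tmax → ℕ
  | .idle => 0
  | .busy t _ _ _ => tmax - t

/-- A bound for the number of slots for which a transmission in progress may last after the
current slot. -/
def Channel.remainingAfter {tmax : ℕ} : Channel tmax → Bool → ℕ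
  | .idle, a => if a then tmax - 1 else 0
  | .busy t _ _ _, _ => tmax - (t + 1)

theorem remaining_afterSlot_le (tmax t : ℕ) (ht : 0 < t) (d : Bool) :
    (afterSlot tmax t ht d).remaining ≤ tmax - t := by
  unfold afterSlot
  split <;> simp [Channel.remaining]

theorem nextAge_eq (Δ : ℕ) (f e : Bool) : nextAge Δ f e = 0 ∨ nextAge Δ f e = Δ + 1 := by
  unfold nextAge
  split
  · exact .inr rfl
  · exact .inl rfl

theorem Params.mem_support_transmitSlot {Δ t : ℕ} {d : Bool} {s' : State c.tmax}
    (h : s' ∈ (c.transmitSlot Δ t d).support) :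
    (s'.age = 0 ∨ s'.age = Δ + 1) ∧ s'.channel.remaining ≤ c.tmax - (t + 1) := by
  simp only [Params.transmitSlot, PMF.mem_support_bind_iff, PMF.mem_support_pure_iff] at h
  obtain ⟨f, -, u, -, rfl⟩ := h
  cases u
  · exact ⟨nextAge_eq .., Nat.zero_le _⟩
  · exact ⟨nextAge_eq .., remaining_afterSlot_le ..⟩

theorem Params.mem_support_step {s s' : State c.tmax} {a : Bool} (h : s' ∈ (c.step s a).support) :
    (s'.age = 0 ∨ s'.age = s.age + 1) ∧
      s'.channel.remaining ≤ s.channel.remainingAfter a := by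
  obtain ⟨Δ, ch⟩ := s
  cases ch with
  | idle =>
    cases a with
    | false =>
      simp only [Params.step, Params.idleSlot, PMF.mem_support_bind_iff, PMF.mem_support_pure_iff,
        Bool.false_eq_true, if_false] at h
      obtain ⟨f, -, rfl⟩ := h
      exact ⟨nextAge_eq .., le_rfl⟩
    | true =>
      simp only [Params.step, if_true] at h
      exact c.mem_support_transmitSlot h
  | busy t ht hlt d => exact c.mem_support_transmitSlot h

/-- Whatever the estimate becomes, one of the two outcomes of the source is correct. -/
theorem Params.p_le_nextAge (Δ : ℕ) (e : Bool) :
    (c.p : ℝ) ≤ c.p * (if nextAge Δ true e = 0 then 1 else 0) +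
      (1 - c.p) * (if nextAge Δ false e = 0 then 1 else 0) := by
  have h := c.two_mul_p_le_one
  cases hΔ : decide (0 < Δ) <;> cases e <;> simp [nextAge, hΔ] <;> linarith

theorem Params.p_le_expect_transmitSlot (Δ t : ℕ) (d : Bool) :
    (c.p : ℝ) ≤ expect (c.transmitSlot Δ t d) fun s => if s.age = 0 then 1 else 0 := by
  rw [c.expect_transmitSlot]
  have h1 := mul_le_mul_of_nonneg_left (c.p_le_nextAge Δ false)
    (ENNReal.toReal_nonneg (a := c.stay t))
  have h2 := mul_le_mul_of_nonneg_left (c.p_le_nextAge Δ d)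
    (sub_nonneg.2 (c.stay_toReal_le_one t))
  dsimp only
  linarith

theorem Params.p_le_expect_step (s : State c.tmax) (a : Bool) :
    (c.p : ℝ) ≤ expect (c.step s a) fun s => if s.age = 0 then 1 else 0 := by
  unfold Params.step
  split
  · split
    · exact c.p_le_expect_transmitSlot ..
    · rw [c.expect_idleSlot]
      exact c.p_le_nextAge s.age false
  · exact c.p_le_expect_transmitSlot ..

/-- All that the drift and contraction arguments use about a slot: age `0` has probability at least
`p`, and the worse bound `b₁` takes the rest. -/
theorem Params.expect_step_le (s : State c.tmax) (a : Bool) {V : State c.tmax → ℝ} {b₀ b₁ : ℝ}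
    (hb : b₀ ≤ b₁) (h₀ : ∀ s' ∈ (c.step s a).support, s'.age = 0 → V s' ≤ b₀)
    (h₁ : ∀ s' ∈ (c.step s a).support, s'.age ≠ 0 → V s' ≤ b₁) :
    expect (c.step s a) V ≤ c.p * b₀ + (1 - c.p) * b₁ := by
  have h : expect (c.step s a) V ≤
      expect (c.step s a) fun s => b₁ - (b₁ - b₀) * (if s.age = 0 then 1 else 0) :=
    expect_mono (c.support_step_finite s a) fun s' hs' => by
      by_cases h0 : s'.age = 0
      · simpa [h0] using h₀ s' hs' h0
      · simpa [h0] using h₁ s' hs' h0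
  rw [expect_sub (c.support_step_finite s a), expect_const (c.support_step_finite s a),
    expect_const_mul] at h
  nlinarith [mul_le_mul_of_nonneg_left (c.p_le_expect_step s a) (sub_nonneg.2 hb)]

/-! ### The Lyapunov function -/

/-- The state with correct estimate and idle channel. -/
def base (tmax : ℕ) : State tmax := ⟨0, .idle⟩

/-- The height of the Lyapunov function at positive ages. -/
noncomputable def Params.height : ℝ :=
  (∑ i ∈ Finset.range c.tmax, (c.p : ℝ) ^ i) / (c.p : ℝ) ^ (c.tmax + 1)

/-- The Lyapunov function at age `0`, if the channel becomes idle within `r` slots. -/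
noncomputable def Params.heightZero (r : ℕ) : ℝ :=
  (1 + (1 - c.p) * (1 / c.p + c.height)) * ∑ i ∈ Finset.range r, (c.p : ℝ) ^ i

/-- The number of slots after which the channel has been idle again. -/
def Channel.untilIdle {tmax : ℕ} : Channel tmax → ℕ
  | .idle => tmax
  | .busy t _ _ _ => tmax - t

/-- The slope `1 / p` pays for the cost while the age grows, as an excursion survives each slot with
probability at most `1 - p`. At age `0` the value depends on the channel, because only the idle
channel there is the target state. -/
noncomputable def Params.lyapunov (s : State c.tmax) : ℝ :=
  if s.age = 0 then c.heightZero s.channel.untilIdle else s.age / c.p + c.height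

theorem Params.height_nonneg : 0 ≤ c.height := by
  unfold Params.height
  positivity

theorem Params.heightZero_factor_pos : 0 < 1 + (1 - c.p) * (1 / c.p + c.height) := by
  have h1 := c.height_nonneg
  have h2 := c.p_pos_real
  have h3 : (0 : ℝ) < 1 - c.p := by linarith [c.two_mul_p_le_one]
  positivity

theorem Params.heightZero_mono : Monotone c.heightZero := by
  intro r r' h
  refine mul_le_mul_of_nonneg_left ?_ c.heightZero_factor_pos.le
  exact Finset.sum_le_sum_of_subset_of_nonneg (Finset.range_mono h)
    fun i _ _ => pow_nonneg c.p_pos_real.le i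

theorem Params.heightZero_nonneg (r : ℕ) : 0 ≤ c.heightZero r :=
  mul_nonneg c.heightZero_factor_pos.le
    (Finset.sum_nonneg fun i _ => pow_nonneg c.p_pos_real.le i)

/-- The drift inequality at age `0`, with equality: one slot costs `1`, then the age becomes `1`
with weight `1 - p`, or stays `0` with one slot less to wait. -/
theorem Params.heightZero_succ (r : ℕ) :
    c.heightZero (r + 1) = 1 + (1 - c.p) * (1 / c.p + c.height) + c.p * c.heightZero r := by
  unfold Params.heightZero
  rw [geom_sum_succ]
  ring

/-- This equation determines `height`. It makes `heightZero` at most `height` for all waiting times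
up to `tmax`, which is the drift inequality at positive ages. -/
theorem Params.heightZero_tmax : c.heightZero c.tmax = c.height := by
  have hp := c.p_pos_real
  have h1 := mul_neg_geom_sum (c.p : ℝ) c.tmax
  unfold Params.heightZero Params.height
  set σ := ∑ i ∈ Finset.range c.tmax, (c.p : ℝ) ^ i
  have h2 : (c.p : ℝ) ^ c.tmax ≠ 0 := by positivity
  rw [pow_succ]
  field_simp
  linear_combination (σ : ℝ) * h1

theorem Channel.untilIdle_le {tmax : ℕ} (ch : Channel tmax) : ch.untilIdle ≤ tmax := by
  cases ch <;> simp [Channel.untilIdle]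

theorem Channel.remainingAfter_lt {tmax : ℕ} (h : 1 < tmax) (ch : Channel tmax) (a : Bool) :
    ch.remainingAfter a + 1 ≤ ch.untilIdle := by
  cases ch with
  | idle => cases a <;> simp [Channel.untilIdle, Channel.remainingAfter] <;> omega
  | busy t ht hlt d => simp only [Channel.untilIdle, Channel.remainingAfter]; omega

theorem Params.lyapunov_nonneg (s : State c.tmax) : 0 ≤ c.lyapunov s := by
  have h1 := c.height_nonneg
  have h2 := c.p_pos_real
  unfold Params.lyapunov
  split
  · exact c.heightZero_nonneg _
  · positivity

theorem Params.heightZero_le_height {r : ℕ} (h : r ≤ c.tmax) : c.heightZero r ≤ c.height :=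
  c.heightZero_tmax ▸ c.heightZero_mono h

theorem Params.lyapunov_le (s : State c.tmax) : c.lyapunov s ≤ s.age / c.p + c.height := by
  unfold Params.lyapunov
  split
  · have := c.heightZero_le_height s.channel.untilIdle_le
    have : 0 ≤ (s.age : ℝ) / c.p := by positivity
    linarith
  · exact le_rfl

/-- Redirection only lowers the age, so by monotonicity the truncated processes inherit the drift
inequality with unchanged constants. -/
theorem Params.lyapunov_mono {Δ Δ' : ℕ} (h : Δ ≤ Δ') (ch : Channel c.tmax) :
    c.lyapunov ⟨Δ, ch⟩ ≤ c.lyapunov ⟨Δ', ch⟩ := by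
  rcases Nat.eq_zero_or_pos Δ' with rfl | hpos
  · rw [Nat.le_zero.1 h]
  · refine (c.lyapunov_le _).trans ?_
    rw [Params.lyapunov, if_neg (Nat.pos_iff_ne_zero.1 hpos)]
    have hp := c.p_pos_real
    gcongr

theorem Params.lyapunov_drift (s : State c.tmax) (a : Bool) :
    1 + (s.age : ℝ) + expect (c.step s a) (Set.indicator {base c.tmax}ᶜ c.lyapunov) ≤
      c.lyapunov s := by
  have hp := c.p_pos_real
  have hr := s.channel.remainingAfter_lt c.one_lt_tmax a
  have hle : s.channel.remainingAfter a ≤ c.tmax := by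
    have := s.channel.untilIdle_le
    omega
  have h0 : (0 : ℝ) ≤ (s.age + 1 : ℕ) / c.p := by positivity
  have key := c.expect_step_le s a (V := Set.indicator {base c.tmax}ᶜ c.lyapunov)
    (b₀ := c.heightZero (s.channel.remainingAfter a)) (b₁ := (s.age + 1 : ℕ) / c.p + c.height)
    (by linarith [c.heightZero_le_height hle])
    (fun s' hs' hage => by
      obtain ⟨Δ, ch⟩ := s'
      obtain rfl : Δ = 0 := hage
      cases ch with
      | idle =>
        rw [Set.indicator_of_notMem (by simp [base])]
        exact c.heightZero_nonneg _
      | busy t ht hlt d =>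
        rw [Set.indicator_of_mem (by simp [base]), Params.lyapunov, if_pos rfl]
        exact c.heightZero_mono (c.mem_support_step hs').2)
    (fun s' hs' hage => by
      refine (Set.indicator_le_self' (fun _ _ => c.lyapunov_nonneg _) s').trans ?_
      rw [← (c.mem_support_step hs').1.resolve_left hage]
      exact c.lyapunov_le s')
  have h1 := c.heightZero_mono hr
  rw [c.heightZero_succ] at h1
  have h2 : (c.p : ℝ) * (1 / c.p) = 1 := by field_simp
  have h3 : ((s.age + 1 : ℕ) : ℝ) / c.p = s.age * (1 / c.p) + 1 / c.p := by push_cast; ring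
  have h4 : (c.p : ℝ) * (s.age * (1 / c.p)) = s.age := by rw [mul_left_comm, h2, mul_one]
  have h5 : (s.age : ℝ) / c.p = s.age * (1 / c.p) := by ring
  rw [h3] at key
  by_cases hs : s.age = 0
  · rw [show c.lyapunov s = c.heightZero s.channel.untilIdle from if_pos hs]
    rw [hs] at key ⊢
    push_cast at key ⊢
    linarith
  · rw [show c.lyapunov s = s.age / c.p + c.height from if_neg hs]
    have := c.heightZero_le_height s.channel.untilIdle_le
    rw [h5]
    linarith

theorem Params.lyapunov_le_mul (s : State c.tmax) :
    c.lyapunov s ≤ (1 / c.p + c.height) * (1 + s.age) := by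
  have h1 := c.height_nonneg
  have h2 : (0 : ℝ) ≤ 1 / c.p := by positivity
  have h3 : (0 : ℝ) ≤ c.height * s.age := by positivity
  have := c.lyapunov_le s
  have h5 : (s.age : ℝ) / c.p = s.age * (1 / c.p) := by ring
  linarith

theorem Params.drift_mdp : Drift c.mdp (base c.tmax) c.lyapunov (1 / c.p + c.height) where
  finite := c.support_step_finite
  nonneg := c.lyapunov_nonneg
  drift := fun s a => by simpa [Params.mdp] using c.lyapunov_drift s a
  le_mul := fun s => by simpa [Params.mdp] using c.lyapunov_le_mul s

/-! ### The truncated processes -/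

/-- The state with correct estimate and idle channel, in the truncated process. -/
def truncBase (tmax m : ℕ) : TruncState tmax m := ⟨base tmax, Nat.zero_le m⟩

theorem Params.support_truncMDP_finite (m : ℕ) (s : TruncState c.tmax m) (a : Bool) :
    ((c.truncMDP m).trans s a).support.Finite :=
  support_map_finite (c.support_step_finite _ _) _

theorem Params.expect_truncMDP (m : ℕ) (s : TruncState c.tmax m) (a : Bool)
    (V : TruncState c.tmax m → ℝ) :
    expect ((c.truncMDP m).trans s a) V = expect (c.step s.1 a) fun t => V (redirect m t) :=
  expect_map (c.support_step_finite _ _) _ _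

theorem Params.lyapunov_redirect_le (m : ℕ) (s : State c.tmax) :
    c.lyapunov (redirect m s).1 ≤ c.lyapunov s :=
  c.lyapunov_mono (min_le_left _ _) _

theorem Params.drift_truncMDP (m : ℕ) :
    Drift (c.truncMDP m) (truncBase c.tmax m) (fun s => c.lyapunov s.1) (1 / c.p + c.height) where
  finite := c.support_truncMDP_finite m
  nonneg := fun s => c.lyapunov_nonneg s.1
  drift := fun s a => by
    refine le_trans ?_ (c.lyapunov_drift s.1 a)
    rw [c.expect_truncMDP]
    refine add_le_add (by simp [Params.truncMDP]) ?_
    refine expect_mono (c.support_step_finite _ _) fun t _ => ?_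
    by_cases ht : t = base c.tmax
    · subst ht
      rw [Set.indicator_of_notMem, Set.indicator_of_notMem (by simp)]
      have : redirect m (base c.tmax) = truncBase c.tmax m := by
        simp [redirect, truncBase, base]
      simp [this]
    · rw [Set.indicator_of_mem (s := {base c.tmax}ᶜ) ht]
      exact (Set.indicator_le_self' (fun _ _ => c.lyapunov_nonneg _) _).trans
        (c.lyapunov_redirect_le m t)
  le_mul := fun s => by simpa [Params.truncMDP] using c.lyapunov_le_mul s.1

/-! ### Finiteness and countability of the state spaces -/

/-- A state of the channel, in coordinates. -/
def Channel.coords {tmax : ℕ} : Channel tmax → Option (Fin tmax × Bool)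
  | .idle => none
  | .busy t _ hlt d => some (⟨t, hlt⟩, d)

theorem Channel.coords_injective {tmax : ℕ} : Function.Injective (Channel.coords (tmax := tmax)) := by
  intro x y h
  cases x <;> cases y <;> simp_all [Channel.coords]

instance {tmax : ℕ} : Finite (Channel tmax) := Finite.of_injective _ Channel.coords_injective

instance {tmax : ℕ} : Countable (State tmax) :=
  Function.Injective.countable (f := fun s : State tmax => (s.age, s.channel)) fun s t h => by
    cases s; cases t; simp_all

instance {tmax m : ℕ} : Finite (TruncState tmax m) :=
  Finite.of_injective
    (fun s : TruncState tmax m => ((⟨s.1.age, Nat.lt_succ_of_le s.2⟩ : Fin (m + 1)), s.1.channel))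
    fun s t h => by
      obtain ⟨⟨_, _⟩, _⟩ := s
      obtain ⟨⟨_, _⟩, _⟩ := t
      simp_all

instance {c : Params} {m : ℕ} : Finite (StationaryPolicy (c.truncMDP m)) :=
  Finite.of_injective (fun f => f.act) fun f f' h => by
    cases f; cases f'; simp_all

end System

/-! ### Value iteration -/

section Bellman

variable {S A : Type} {M : MDP S A} {z : S} {W : S → ℝ} {B : ℝ}

theorem MDP.bellman_le (M : MDP S A) (V : S → ℝ) {s : S} {a : A} (ha : a ∈ M.actions s) :
    M.bellman V s ≤ M.cost s + expect (M.trans s a) V :=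
  Finset.inf'_le _ ha

theorem MDP.exists_bellman_eq (M : MDP S A) (V : S → ℝ) (s : S) :
    ∃ a ∈ M.actions s, M.bellman V s = M.cost s + expect (M.trans s a) V :=
  Finset.exists_mem_eq_inf' _ _

theorem MDP.bellman_sub_const (hM : ∀ s a, (M.trans s a).support.Finite) (V : S → ℝ) (r : ℝ)
    (s : S) : M.bellman (fun t => V t - r) s = M.bellman V s - r := by
  have h : ∀ a, expect (M.trans s a) (fun t => V t - r) = expect (M.trans s a) V - r := fun a => by
    rw [expect_sub (hM s a), expect_const (hM s a)]
  refine le_antisymm ?_ ?_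
  · obtain ⟨a, ha, e⟩ := M.exists_bellman_eq V s
    have := M.bellman_le (fun t => V t - r) ha
    rw [h] at this
    linarith
  · obtain ⟨a, ha, e⟩ := M.exists_bellman_eq (fun t => V t - r) s
    rw [h] at e
    linarith [M.bellman_le V ha]

/-- Value iteration for the total cost. -/
noncomputable def MDP.valueIter (M : MDP S A) (n : ℕ) : S → ℝ := M.bellman^[n] 0

theorem MDP.valueIter_succ (M : MDP S A) (n : ℕ) :
    M.valueIter (n + 1) = M.bellman (M.valueIter n) :=
  Function.iterate_succ_apply' _ _ _

theorem MDP.rvi_eq (hM : ∀ s a, (M.trans s a).support.Finite) (ref : S) (n : ℕ) :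
    M.rvi ref n = fun s => M.valueIter n s - M.valueIter n ref := by
  induction n with
  | zero => simp [MDP.rvi, MDP.valueIter]
  | succ n ih =>
    funext s
    simp only [MDP.rvi, ih, MDP.bellman_sub_const hM, M.valueIter_succ]
    ring

theorem MDP.rvi_ref (M : MDP S A) (ref : S) (n : ℕ) : M.rvi ref n ref = 0 := by
  cases n <;> simp [MDP.rvi]

theorem MDP.exists_rviReturns (M : MDP S A) {ref : S} {ε : ℝ}
    (h : ∃ n, ∀ s, |M.rvi ref (n + 1) s - M.rvi ref n s| ≤ ε) :
    ∃ f : StationaryPolicy M, M.RVIReturns ref ε f := by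
  classical
  choose a ha hq using M.exists_bellman_eq (M.rvi ref (Nat.find h))
  exact ⟨⟨a, ha⟩, Nat.find h, ⟨Nat.find_spec h, fun n hn => Nat.find_min' h hn⟩,
    fun s b hb => (hq s).symm.trans_le (M.bellman_le _ hb)⟩

/-- What relative value iteration returns is greedy for an approximate solution of the optimality
equation. -/
theorem MDP.RVIReturns.exists_greedy {ref : S} {ε : ℝ} {f : StationaryPolicy M}
    (h : M.RVIReturns ref ε f) :
    ∃ (γ : ℝ) (V : S → ℝ), V ref = 0 ∧ (∀ s, |M.bellman V s - γ - V s| ≤ ε) ∧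
      ∀ s, M.bellman V s = M.cost s + expect (M.trans s (f.act s)) V := by
  obtain ⟨ν, hν, hf⟩ := h
  refine ⟨M.bellman (M.rvi ref ν) ref, M.rvi ref ν, M.rvi_ref ref ν, hν.1, fun s => ?_⟩
  exact le_antisymm (M.bellman_le _ (f.feasible s)) (Finset.le_inf' _ _ (hf s))

theorem Drift.exists_bound [Finite S] (d : Drift M z W B) (V : S → ℝ) :
    ∃ K, 0 ≤ K ∧ ∀ s, |V s| ≤ K * W s := by
  obtain ⟨K, hK⟩ := (Set.finite_range fun s => |V s|).bddAbove
  have hK' : ∀ s, |V s| ≤ K := fun s => hK ⟨s, rfl⟩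
  have hK0 : 0 ≤ K := (abs_nonneg (V z)).trans (hK' z)
  exact ⟨K, hK0, fun s => (hK' s).trans (le_mul_of_one_le_right hK0 (d.one_le s))⟩

theorem Drift.le_avgCost_of_approx [Finite S] (d : Drift M z W B) {γ ε : ℝ} {V : S → ℝ}
    (hV : ∀ s, |M.bellman V s - γ - V s| ≤ ε) (χ : Policy M) (s₀ : S) :
    ENNReal.ofReal (γ - ε) ≤ χ.avgCost s₀ := by
  obtain ⟨K, hK, hVK⟩ := d.exists_bound V
  refine d.le_avgCost χ s₀ hK hVK fun l s a ha => ?_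
  linarith [(abs_le.1 (hV s)).1, M.bellman_le V (χ.feasible l s a ha)]

theorem Drift.avgCost_le_of_approx [Finite S] (d : Drift M z W B) {γ ε : ℝ} {V : S → ℝ}
    {f : StationaryPolicy M} (hV : ∀ s, |M.bellman V s - γ - V s| ≤ ε)
    (hf : ∀ s, M.bellman V s = M.cost s + expect (M.trans s (f.act s)) V) (s₀ : S) :
    f.toPolicy.avgCost s₀ ≤ ENNReal.ofReal (γ + ε) := by
  obtain ⟨K, hK, hVK⟩ := d.exists_bound V
  refine d.avgCost_le _ s₀ hK hVK fun l s a ha => ?_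
  rw [(PMF.mem_support_pure_iff _ _).1 ha, ← hf s]
  linarith [(abs_le.1 (hV s)).2]

/-- The same approximate solution gives `γ - ε` as a lower bound for all policies and `γ + ε` as an
upper bound for the greedy one. -/
theorem Drift.avgCost_le_add [Finite S] (d : Drift M z W B) {ref : S} {ε : ℝ}
    {f : StationaryPolicy M} (h : M.RVIReturns ref ε f) (χ : Policy M) (s₀ : S) :
    f.toPolicy.avgCost s₀ ≤ χ.avgCost s₀ + ENNReal.ofReal (2 * ε) := by
  obtain ⟨γ, V, -, hV, hf⟩ := h.exists_greedy
  calc f.toPolicy.avgCost s₀ ≤ ENNReal.ofReal (γ - ε + 2 * ε) := by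
        convert d.avgCost_le_of_approx hV hf s₀ using 2
        ring
    _ ≤ _ := ENNReal.ofReal_add_le
    _ ≤ _ := add_le_add_left (d.le_avgCost_of_approx hV χ s₀) _

theorem Drift.exists_averages (d : Drift M z W B) :
    ∃ J : StationaryPolicy M → ℝ, (∀ f, 0 ≤ J f) ∧
      ∀ f s, f.toPolicy.avgCost s = ENNReal.ofReal (J f) := by
  choose J h h0 _ hh H using d.exists_evaluation
  exact ⟨J, h0, fun f s => d.avgCost_eq f s (by linarith [d.nonneg z]) (hh f) (H f)⟩

/-- If relative value iteration halts for every tolerance, then some stationary policy is optimal,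
and relative value iteration returns optimal policies for all small tolerances. -/
theorem Drift.exists_isOptimal [Finite S] [Finite (StationaryPolicy M)] (d : Drift M z W B)
    (hM : ∀ ε : ℝ, 0 < ε → ∃ f, M.RVIReturns z ε f) :
    (∃ f : StationaryPolicy M, f.IsOptimal) ∧ ∀ ref, ∃ ε₀ : ℝ, 0 < ε₀ ∧ ∀ ε : ℝ, 0 < ε → ε ≤ ε₀ →
      ∀ f, M.RVIReturns ref ε f → f.IsOptimal := by
  obtain ⟨J, hJ0, hJ⟩ := d.exists_averages
  obtain ⟨f₁, -⟩ := hM 1 one_pos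
  have : Nonempty (StationaryPolicy M) := ⟨f₁⟩
  -- A best stationary policy does at least as well as every output of relative value iteration, and
  -- those come arbitrarily close to any competitor.
  obtain ⟨f₀, hf₀⟩ := Finite.exists_min J
  have hopt : f₀.IsOptimal := by
    refine fun s χ => ENNReal.le_of_forall_pos_le_add fun ε hε _ => ?_
    have hε' : (0 : ℝ) < ε := hε
    obtain ⟨f, hf⟩ := hM (ε / 2) (by positivity)
    calc f₀.toPolicy.avgCost s ≤ f.toPolicy.avgCost s := by
          rw [hJ, hJ]
          exact ENNReal.ofReal_le_ofReal (hf₀ f)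
      _ ≤ _ := d.avgCost_le_add hf χ s
      _ = _ := by rw [mul_div_cancel₀ _ two_ne_zero, ENNReal.ofReal_coe_nnreal]
  refine ⟨⟨f₀, hopt⟩, fun ref => ?_⟩
  -- Finitely many stationary policies leave a positive gap above the optimal average cost; a
  -- tolerance with `2 * ε` below the gap excludes all suboptimal outputs.
  have hev : ∀ᶠ ε : ℝ in nhdsWithin 0 (Set.Ioi 0), ∀ f, J f₀ < J f → J f₀ + 2 * ε < J f := by
    refine eventually_all.2 fun f => eventually_imp_distrib_left.2 fun hlt => ?_
    have ht : Tendsto (fun ε : ℝ => J f₀ + 2 * ε) (nhdsWithin 0 (Set.Ioi 0)) (nhds (J f₀)) := by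
      refine tendsto_nhdsWithin_of_tendsto_nhds ?_
      have : Continuous fun ε : ℝ => J f₀ + 2 * ε := by fun_prop
      simpa using this.tendsto 0
    exact ht.eventually_lt_const hlt
  obtain ⟨ε₀, hε₀, hpos⟩ := (hev.and self_mem_nhdsWithin).exists
  refine ⟨ε₀, hpos, fun ε hε hle f hf s χ => (?_ : _ ≤ f₀.toPolicy.avgCost s).trans (hopt s χ)⟩
  have h1 := d.avgCost_le_add hf f₀.toPolicy s
  rw [hJ, hJ, ← ENNReal.ofReal_add (hJ0 _) (by positivity),
    ENNReal.ofReal_le_ofReal_iff (add_nonneg (hJ0 _) (by positivity))] at h1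
  rw [hJ, hJ]
  refine ENNReal.ofReal_le_ofReal (not_lt.1 fun hlt => ?_)
  linarith [hε₀ f hlt]

end Bellman

/-! ### Convergence of value iteration in the truncated processes -/

section Truncated

variable (c : Params) {m : ℕ}

/-- An update that equals the estimate is worth nothing: being idle is at least as good as
transmitting it. -/
def IdleLE (V : TruncState c.tmax m → ℝ) : Prop :=
  ∀ Δ t ht hlt h, V ⟨⟨Δ, .idle⟩, h⟩ ≤ V ⟨⟨Δ, .busy t ht hlt false⟩, h⟩

variable {c}

/-- Delivering an update equal to the estimate leaves the estimate as it is, so the age has the same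
law as under idling; only the channel may stay busy, which `IdleLE` penalizes. -/
theorem IdleLE.expect_le {V : TruncState c.tmax m → ℝ} (hV : IdleLE c V) (Δ t : ℕ) :
    expect (c.idleSlot Δ) (fun s => V (redirect m s)) ≤
      expect (c.transmitSlot Δ t false) (fun s => V (redirect m s)) := by
  have hp := c.p_pos_real
  have hp1 : (0 : ℝ) ≤ 1 - c.p := by linarith [c.two_mul_p_le_one]
  have hu := ENNReal.toReal_nonneg (a := c.stay t)
  have h : ∀ Δ', V (redirect m ⟨Δ', .idle⟩) ≤
      (c.stay t).toReal * V (redirect m ⟨Δ', afterSlot c.tmax (t + 1) t.succ_pos false⟩) +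
        (1 - (c.stay t).toReal) * V (redirect m ⟨Δ', .idle⟩) := by
    intro Δ'
    have h1 : V (redirect m ⟨Δ', .idle⟩) ≤
        V (redirect m ⟨Δ', afterSlot c.tmax (t + 1) t.succ_pos false⟩) := by
      unfold afterSlot
      split
      · exact hV ..
      · exact le_rfl
    linarith [mul_le_mul_of_nonneg_left h1 hu]
  rw [c.expect_idleSlot, c.expect_transmitSlot]
  exact add_le_add (mul_le_mul_of_nonneg_left (h _) hp.le)
    (mul_le_mul_of_nonneg_left (h _) hp1)

theorem IdleLE.bellman {V : TruncState c.tmax m → ℝ} (hV : IdleLE c V) :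
    IdleLE c ((c.truncMDP m).bellman V) := by
  intro Δ t ht hlt h
  obtain ⟨a, -, e⟩ := (c.truncMDP m).exists_bellman_eq V ⟨⟨Δ, .busy t ht hlt false⟩, h⟩
  rw [e]
  refine ((c.truncMDP m).bellman_le V (a := false) (by simp [Params.truncMDP,
    feasibleActions])).trans ?_
  rw [c.expect_truncMDP, c.expect_truncMDP]
  exact add_le_add_right (hV.expect_le Δ t) _

/-- In the base state a fresh update equals the estimate, so the minimizer there may be taken to be
idling. This excludes periodicity. -/
theorem IdleLE.exists_bellman_eq {V : TruncState c.tmax m → ℝ} (hV : IdleLE c V)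
    (s : TruncState c.tmax m) : ∃ a ∈ (c.truncMDP m).actions s,
      (s = truncBase c.tmax m → a = false) ∧
      (c.truncMDP m).bellman V s =
        (c.truncMDP m).cost s + expect ((c.truncMDP m).trans s a) V := by
  obtain ⟨a, ha, e⟩ := (c.truncMDP m).exists_bellman_eq V s
  by_cases hs : s = truncBase c.tmax m
  · have hf : false ∈ (c.truncMDP m).actions s := by
      subst hs
      simp [Params.truncMDP, feasibleActions, truncBase, base]
    refine ⟨false, hf, fun _ => rfl, ((c.truncMDP m).bellman_le V hf).antisymm ?_⟩
    rw [e]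
    cases a
    · exact le_rfl
    · subst hs
      rw [c.expect_truncMDP, c.expect_truncMDP]
      exact add_le_add_right (hV.expect_le 0 0) _
  · exact ⟨a, ha, fun h => (hs h).elim, e⟩

theorem idleLE_valueIter (n : ℕ) : IdleLE c ((c.truncMDP m).valueIter n) := by
  induction n with
  | zero => exact fun _ _ _ _ _ => le_rfl
  | succ n ih =>
    rw [MDP.valueIter_succ]
    exact ih.bellman

theorem expect_truncMDP_le (s : TruncState c.tmax m) (a : Bool) {V : TruncState c.tmax m → ℝ}
    {b₀ b₁ : ℝ} (hb : b₀ ≤ b₁)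
    (h₀ : ∀ t : TruncState c.tmax m, t.1.age = 0 →
      t.1.channel.remaining ≤ s.1.channel.remainingAfter a → V t ≤ b₀)
    (h₁ : ∀ t, V t ≤ b₁) :
    expect ((c.truncMDP m).trans s a) V ≤ c.p * b₀ + (1 - c.p) * b₁ := by
  rw [c.expect_truncMDP]
  refine c.expect_step_le s.1 a hb (fun t ht h0 => h₀ _ ?_ (c.mem_support_step ht).2)
    fun t _ _ => h₁ _
  simp [redirect, h0]

/-- Whatever happens, the base state is reached within `tmax` slots with positive probability;
if the channel idles there, the process is then in the base state at time `tmax`. -/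
theorem le_of_step {X : ℕ → TruncState c.tmax m → ℝ}
    (hX : ∀ n s, ∃ a, (s = truncBase c.tmax m → a = false) ∧
      X (n + 1) s ≤ expect ((c.truncMDP m).trans s a) (X n))
    {n : ℕ} {b : ℝ} (hb : ∀ s, X n s ≤ b) (s : TruncState c.tmax m) :
    X (n + c.tmax) s ≤ b - (c.p : ℝ) ^ c.tmax * (b - X n (truncBase c.tmax m)) := by
  have hp := c.p_pos_real
  have hall : ∀ j s, X (n + j) s ≤ b := by
    intro j
    induction j with
    | zero => exact hb
    | succ j ih =>
      intro s
      obtain ⟨a, -, ha⟩ := hX (n + j) s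
      refine ha.trans ((expect_mono (c.support_truncMDP_finite m s a) fun t _ => ih t).trans_eq ?_)
      exact expect_const (c.support_truncMDP_finite m s a) b
  have hdef : ∀ j : ℕ, 0 ≤ (c.p : ℝ) ^ j * (b - X n (truncBase c.tmax m)) := fun j =>
    mul_nonneg (pow_nonneg hp.le j) (sub_nonneg.2 (hb _))
  -- At age `0` with at most `j` slots of transmission left, each slot keeps the age at `0` with
  -- probability at least `p`; once the base state is reached, idling keeps the channel free.
  have hnear : ∀ j (s : TruncState c.tmax m), s.1.age = 0 → s.1.channel.remaining ≤ j →
      X (n + j) s ≤ b - (c.p : ℝ) ^ j * (b - X n (truncBase c.tmax m)) := by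
    intro j
    induction j with
    | zero =>
      rintro ⟨⟨Δ, ch⟩, hs⟩ h0 hr
      obtain rfl : Δ = 0 := h0
      cases ch with
      | idle =>
        refine le_of_eq ?_
        change X n (truncBase c.tmax m) = _
        ring
      | busy t ht hlt d =>
        simp only [Channel.remaining] at hr
        omega
    | succ j ih =>
      rintro s h0 hr
      obtain ⟨a, hsa, ha⟩ := hX (n + j) s
      refine ha.trans ((expect_truncMDP_le s a (b₁ := b) (by linarith [hdef j])
        (fun t ht htr => ih t ht (htr.trans ?_)) (hall j)).trans_eq (by ring))
      obtain ⟨⟨Δ, ch⟩, hs⟩ := s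
      obtain rfl : Δ = 0 := h0
      cases ch with
      | idle =>
        obtain rfl := hsa rfl
        simp [Channel.remainingAfter]
      | busy t ht hlt d =>
        simp only [Channel.remainingAfter, Channel.remaining] at hr ⊢
        omega
  -- One slot brings the age to `0` with at most `tmax - 1` slots of transmission left; the other
  -- `tmax - 1` slots are covered by `hnear`.
  obtain ⟨j, hj⟩ : ∃ j, c.tmax = j + 1 := ⟨c.tmax - 1, by have := c.one_lt_tmax; omega⟩
  have key : X (n + (j + 1)) s ≤
      b - (c.p : ℝ) ^ (j + 1) * (b - X n (truncBase c.tmax m)) := by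
    obtain ⟨a, -, ha⟩ := hX (n + j) s
    refine ha.trans ((expect_truncMDP_le s a (b₁ := b) (by linarith [hdef j])
      (fun t ht htr => hnear j t ht (htr.trans ?_)) (hall j)).trans_eq (by ring))
    have h1 := s.1.channel.remainingAfter_lt c.one_lt_tmax a
    have h2 := s.1.channel.untilIdle_le
    omega
  rwa [← hj] at key

/-! ### Span contraction for the increments of value iteration -/

variable (c)

/-- The increments of value iteration. -/
noncomputable def Params.increment (m n : ℕ) (s : TruncState c.tmax m) : ℝ :=
  (c.truncMDP m).valueIter (n + 1) s - (c.truncMDP m).valueIter n s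

/-- The action is a minimizer for the older iterate, hence merely feasible for the newer one; for
the bound on the negated increment the roles are exchanged. -/
theorem Params.increment_le_step (n : ℕ) (s : TruncState c.tmax m) :
    ∃ a, (s = truncBase c.tmax m → a = false) ∧
      c.increment m (n + 1) s ≤ expect ((c.truncMDP m).trans s a) (c.increment m n) := by
  obtain ⟨a, ha, hsa, e⟩ := (idleLE_valueIter (c := c) (m := m) n).exists_bellman_eq s
  refine ⟨a, hsa, ?_⟩
  have h := (c.truncMDP m).bellman_le ((c.truncMDP m).valueIter (n + 1)) ha
  unfold Params.increment
  rw [expect_sub (c.support_truncMDP_finite m s a), MDP.valueIter_succ _ (n + 1)]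
  nth_rewrite 2 [MDP.valueIter_succ]
  linarith

theorem Params.neg_increment_le_step (n : ℕ) (s : TruncState c.tmax m) :
    ∃ a, (s = truncBase c.tmax m → a = false) ∧
      -c.increment m (n + 1) s ≤
        expect ((c.truncMDP m).trans s a) fun t => -c.increment m n t := by
  obtain ⟨a, ha, hsa, e⟩ := (idleLE_valueIter (c := c) (m := m) (n + 1)).exists_bellman_eq s
  refine ⟨a, hsa, ?_⟩
  have h := (c.truncMDP m).bellman_le ((c.truncMDP m).valueIter n) ha
  unfold Params.increment
  simp only [neg_sub]
  rw [expect_sub (c.support_truncMDP_finite m s a), MDP.valueIter_succ _ (n + 1)]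
  nth_rewrite 1 [MDP.valueIter_succ]
  linarith

/-- Maximum and minimum are both pulled by the fraction `p ^ tmax` towards the same number, the
increment in the base state, which cancels in the difference. -/
theorem Params.increment_contract {n : ℕ} {K : ℝ}
    (h : ∀ s t, c.increment m n s - c.increment m n t ≤ K) (s t : TruncState c.tmax m) :
    c.increment m (n + c.tmax) s - c.increment m (n + c.tmax) t ≤
      (1 - (c.p : ℝ) ^ c.tmax) * K := by
  have : Nonempty (TruncState c.tmax m) := ⟨truncBase c.tmax m⟩
  obtain ⟨u, hu⟩ := Finite.exists_max (c.increment m n)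
  obtain ⟨l, hl⟩ := Finite.exists_min (c.increment m n)
  have h1 := le_of_step (X := c.increment m) (fun n s => c.increment_le_step n s) hu s
  have h2 := le_of_step (X := fun n s => -c.increment m n s)
    (fun n s => c.neg_increment_le_step n s) (n := n) (fun s => neg_le_neg (hl s)) t
  have h3 : (c.p : ℝ) ^ c.tmax ≤ 1 :=
    pow_le_one₀ c.p_pos_real.le (by linarith [c.two_mul_p_le_one, c.p_pos_real])
  have h4 := mul_le_mul_of_nonneg_left (h u l) (sub_nonneg.2 h3)
  linarith

theorem Params.exists_increment_le (m : ℕ) {ε : ℝ} (hε : 0 < ε) :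
    ∃ n, ∀ s t, c.increment m n s - c.increment m n t ≤ ε := by
  have : Nonempty (TruncState c.tmax m) := ⟨truncBase c.tmax m⟩
  obtain ⟨u, hu⟩ := Finite.exists_max (c.increment m 0)
  obtain ⟨l, hl⟩ := Finite.exists_min (c.increment m 0)
  have hn : ∀ n s t, c.increment m (n * c.tmax) s - c.increment m (n * c.tmax) t ≤
      (1 - (c.p : ℝ) ^ c.tmax) ^ n * (c.increment m 0 u - c.increment m 0 l) := by
    intro n
    induction n with
    | zero =>
      intro s t
      simpa using sub_le_sub (hu s) (hl t)
    | succ n ih =>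
      intro s t
      rw [Nat.succ_mul, pow_succ', mul_assoc]
      exact c.increment_contract ih s t
  have h3 : (c.p : ℝ) ^ c.tmax ≤ 1 :=
    pow_le_one₀ c.p_pos_real.le (by linarith [c.two_mul_p_le_one, c.p_pos_real])
  have ht := (tendsto_pow_atTop_nhds_zero_of_lt_one (sub_nonneg.2 h3)
    (sub_lt_self 1 (pow_pos c.p_pos_real c.tmax))).mul_const
      (c.increment m 0 u - c.increment m 0 l)
  rw [zero_mul] at ht
  obtain ⟨n, hlt⟩ := (ht.eventually_lt_const hε).exists
  exact ⟨n * c.tmax, fun s t => (hn n s t).trans hlt.le⟩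

theorem Params.exists_rviReturns (m : ℕ) (ref : TruncState c.tmax m) {ε : ℝ} (hε : 0 < ε) :
    ∃ f, (c.truncMDP m).RVIReturns ref ε f := by
  obtain ⟨n, hn⟩ := c.exists_increment_le m hε
  refine (c.truncMDP m).exists_rviReturns ⟨n, fun s => ?_⟩
  rw [MDP.rvi_eq (c.support_truncMDP_finite m), MDP.rvi_eq (c.support_truncMDP_finite m), abs_le]
  have h1 := hn s ref
  have h2 := hn ref s
  unfold Params.increment at h1 h2
  constructor <;> linarith

end Truncated

/-! ### The limit of the truncated processes -/

section Limit

/-- Solutions of the optimality equation (up to `ε`) and of the evaluation equation of an optimal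
policy of a truncated process, with bounds that do not depend on the truncation. -/
theorem Params.exists_approx (c : Params) (m : ℕ) {f : StationaryPolicy (c.truncMDP m)}
    (hf : f.IsOptimal) {ε : ℝ} (hε : 0 < ε) (hε1 : ε ≤ 1) :
    ∃ (γ g : ℝ) (V w : TruncState c.tmax m → ℝ),
      |γ| ≤ 2 + c.lyapunov (base c.tmax) ∧ |g - γ| ≤ ε ∧
      (∀ s, |V s| ≤ (3 + c.lyapunov (base c.tmax)) * c.lyapunov s.1) ∧
      (∀ s, |w s| ≤ (3 + c.lyapunov (base c.tmax)) * c.lyapunov s.1) ∧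
      (∀ s, ∀ a ∈ (c.truncMDP m).actions s,
        γ - ε + V s ≤ (c.truncMDP m).cost s + expect ((c.truncMDP m).trans s a) V) ∧
      ∀ s, g + w s = (c.truncMDP m).cost s + expect ((c.truncMDP m).trans s (f.act s)) w := by
  have d := c.drift_truncMDP m
  have hfin := c.support_truncMDP_finite m
  obtain ⟨g, w, hg0, hg1, hw, hgw⟩ := d.exists_evaluation f
  obtain ⟨f', hf'⟩ := c.exists_rviReturns m (truncBase c.tmax m) hε
  obtain ⟨γ, V, hVz, hV, hgr⟩ := hf'.exists_greedy
  change g ≤ c.lyapunov (base c.tmax) at hg1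
  change ∀ s, |w s| ≤ (1 + c.lyapunov (base c.tmax)) * c.lyapunov s.1 at hw
  have hW0 := c.lyapunov_nonneg (base c.tmax)
  have hJ : f.toPolicy.avgCost (truncBase c.tmax m) = ENNReal.ofReal g :=
    d.avgCost_eq f _ (c := 1 + c.lyapunov (base c.tmax)) (by linarith) hw hgw
  have h1 : γ - ε ≤ g := by
    have := d.le_avgCost_of_approx hV f.toPolicy (truncBase c.tmax m)
    rw [hJ] at this
    exact (ENNReal.ofReal_le_ofReal_iff hg0).1 this
  -- `ENNReal.ofReal` truncates negative numbers, so the comparison with `g` below needs this sign;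
  -- it follows from the approximate equation at a minimum of `V`.
  have h2 : 0 ≤ γ + ε := by
    have : Nonempty (TruncState c.tmax m) := ⟨truncBase c.tmax m⟩
    obtain ⟨l, hl⟩ := Finite.exists_min V
    have := expect_mono (hfin l (f'.act l)) fun t _ => hl t
    rw [expect_const (hfin l (f'.act l))] at this
    linarith [(abs_le.1 (hV l)).2, hgr l, ((c.truncMDP m).cost l).coe_nonneg]
  have h3 : g ≤ γ + ε := by
    have := (hf (truncBase c.tmax m) f'.toPolicy).trans
      (d.avgCost_le_of_approx hV hgr (truncBase c.tmax m))
    rw [hJ] at this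
    exact (ENNReal.ofReal_le_ofReal_iff h2).1 this
  have hγ : |γ| ≤ 2 + c.lyapunov (base c.tmax) := abs_le.2 ⟨by linarith, by linarith⟩
  -- The bound `K` may depend on `m`; `Drift.abs_le_of_step` replaces it by `3 + W(base)`, which
  -- dominates `|γ| + ε`.
  obtain ⟨K, -, hK⟩ := d.exists_bound V
  refine ⟨γ, g, V, w, hγ, abs_le.2 ⟨by linarith, by linarith⟩,
    d.abs_le_of_step hVz hK fun s => ⟨f'.act s, ?_⟩, fun s => (hw s).trans ?_, fun s a ha => ?_,
    hgw⟩
  · have h4 := abs_expect_le (hfin s (f'.act s)) V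
    have h5 := abs_le.1 h4
    have h6 := abs_le.1 (hV s)
    have h7 := abs_le.1 hγ
    have h8 := ((c.truncMDP m).cost s).coe_nonneg
    have h9 := hgr s
    have h10 := mul_nonneg hW0 h8
    exact abs_le.2 ⟨by linarith, by linarith⟩
  · exact mul_le_mul_of_nonneg_right (by linarith) (c.lyapunov_nonneg _)
  · linarith [(abs_le.1 (hV s)).1, (c.truncMDP m).bellman_le V ha]

theorem exists_tendsto_of_abs_le {ι : Type} (U : Ultrafilter ι) {x : ι → ℝ} {b : ℝ}
    (h : ∀ i, |x i| ≤ b) : ∃ l, Tendsto x U (nhds l) ∧ |l| ≤ b := by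
  obtain ⟨l, hl, hU⟩ := (isCompact_Icc (a := -b) (b := b)).ultrafilter_le_nhds' (U.map x)
    (Eventually.of_forall (f := (U : Filter ι)) fun i => abs_le.1 (h i))
  exact ⟨l, hU, abs_le.2 hl⟩

theorem redirect_of_le {tmax m : ℕ} {s : State tmax} (h : s.age ≤ m) : redirect m s = ⟨s, h⟩ := by
  simp [redirect, h]

theorem Params.isOptimal_of_limit (c : Params) {n : ℕ → ℕ} (hn : StrictMono n)
    (f : ∀ k, StationaryPolicy (c.truncMDP (n k))) (hf : ∀ k, (f k).IsOptimal)
    (φ : StationaryPolicy c.mdp) (hφ : ∀ s, ∀ᶠ k in atTop, AgreeAt (f k) φ s) :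
    φ.IsOptimal := by
  have hε1 : ∀ k : ℕ, 1 / ((k : ℝ) + 1) ≤ 1 := fun k => by
    rw [div_le_one (by positivity)]
    linarith [k.cast_nonneg (α := ℝ)]
  choose γ g V w hγ hg hV hw hVstep hwstep using fun k =>
    c.exists_approx (n k) (hf k) (ε := 1 / ((k : ℝ) + 1)) (by positivity) (hε1 k)
  set b := 3 + c.lyapunov (base c.tmax) with hb
  have hb0 : 0 ≤ b := by linarith [c.lyapunov_nonneg (base c.tmax)]
  -- Along an ultrafilter all bounded sequences converge, so limits in all states exist at once
  -- without a diagonal extraction.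
  let U : Ultrafilter ℕ := Ultrafilter.of atTop
  have hU : (U : Filter ℕ) ≤ atTop := Ultrafilter.of_le _
  have hext : ∀ X : ∀ k, TruncState c.tmax (n k) → ℝ, (∀ k s, |X k s| ≤ b * c.lyapunov s.1) →
      ∃ Y : State c.tmax → ℝ, (∀ s, |Y s| ≤ b * c.lyapunov s) ∧
        ∀ s, Tendsto (fun k => X k (redirect (n k) s)) U (nhds (Y s)) := by
    intro X hX
    choose Y hY hY' using fun s => exists_tendsto_of_abs_le U
      (x := fun k => X k (redirect (n k) s)) (b := b * c.lyapunov s) fun k =>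
        (hX k _).trans (mul_le_mul_of_nonneg_left (c.lyapunov_redirect_le _ _) hb0)
    exact ⟨Y, hY', hY⟩
  obtain ⟨γ', hγ', -⟩ := exists_tendsto_of_abs_le U hγ
  obtain ⟨V', hV'b, hV'⟩ := hext V hV
  obtain ⟨w', hw'b, hw'⟩ := hext w hw
  have hε : Tendsto (fun k : ℕ => 1 / ((k : ℝ) + 1)) U (nhds 0) :=
    tendsto_one_div_add_atTop_nhds_zero_nat.mono_left hU
  -- The optimal average costs and the approximate constants share one limit, so the lower bound and
  -- the cost of `φ` will coincide.
  have hg' : Tendsto g U (nhds γ') := by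
    have h0 : Tendsto (fun k => g k - γ k) U (nhds 0) :=
      squeeze_zero_norm (fun k => hg k) hε
    simpa using h0.add hγ'
  have hage : ∀ s : State c.tmax, ∀ᶠ k in (U : Filter ℕ), s.age ≤ n k := fun s =>
    hU (hn.tendsto_atTop.eventually_ge_atTop s.age)
  have hsub : ∀ s, ∀ a ∈ c.mdp.actions s,
      γ' + V' s ≤ c.mdp.cost s + expect (c.mdp.trans s a) V' := by
    intro s a ha
    have h1 := (hγ'.sub hε).add (hV' s)
    rw [sub_zero] at h1
    have h2 := (tendsto_expect (c.support_step_finite s a) hV').const_add (c.mdp.cost s : ℝ)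
    refine le_of_tendsto_of_tendsto h1 h2 ?_
    filter_upwards [hage s] with k hk
    have := hVstep k ⟨s, hk⟩ a ha
    rw [c.expect_truncMDP] at this
    rwa [redirect_of_le hk]
  have heval : ∀ s, γ' + w' s = c.mdp.cost s + expect (c.mdp.trans s (φ.act s)) w' := by
    intro s
    have h2 := (tendsto_expect (c.support_step_finite s (φ.act s)) hw').const_add
      (c.mdp.cost s : ℝ)
    refine tendsto_nhds_unique_of_eventuallyEq (hg'.add (hw' s)) h2 ?_
    filter_upwards [hage s, hU (hφ s)] with k hk ⟨_, hagree⟩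
    have := hwstep k ⟨s, hk⟩
    rw [c.expect_truncMDP, hagree] at this
    rwa [redirect_of_le hk]
  intro s₀ χ
  rw [c.drift_mdp.avgCost_eq φ s₀ hb0 hw'b heval]
  exact c.drift_mdp.le_avgCost χ s₀ hb0 hV'b fun l s a ha => hsub s a (χ.feasible l s a ha)

/-- Redirection extends each truncated policy to all states; the space of functions from the
countable state space to `Bool` is sequentially compact, and convergence there means eventual
equality in each state. -/
theorem Params.exists_limit (c : Params) {n : ℕ → ℕ} (hn : StrictMono n)
    (f : ∀ k, StationaryPolicy (c.truncMDP (n k))) :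
    ∃ (φ : StationaryPolicy c.mdp) (k : ℕ → ℕ), StrictMono k ∧
      ∀ s, ∀ᶠ j in atTop, AgreeAt (f (k j)) φ s := by
  obtain ⟨x, -, k, hk, hx⟩ := isCompact_univ.tendsto_subseq
    (x := fun k (s : State c.tmax) => (f k).act (redirect (n k) s)) fun _ => Set.mem_univ _
  have hev : ∀ s, ∀ᶠ j in atTop, (f (k j)).act (redirect (n (k j)) s) = x s := fun s => by
    simpa [nhds_discrete, tendsto_pure] using tendsto_pi_nhds.1 hx s
  have hx' : ∀ s, x s ∈ c.mdp.actions s := fun s => by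
    obtain ⟨j, hj⟩ := (hev s).exists
    rw [← hj]
    -- Feasibility depends only on the channel, which redirection preserves.
    exact (f (k j)).feasible (redirect (n (k j)) s)
  refine ⟨⟨x, hx'⟩, k, hk, fun s => ?_⟩
  filter_upwards [hev s, (hn.comp hk).tendsto_atTop.eventually_ge_atTop s.age] with j hj hage
  refine ⟨hage, ?_⟩
  rwa [← redirect_of_le hage]

/-- Otherwise optimal policies that fail on `F` exist for infinitely many `m`; a limit point of them
is optimal and agrees with some of them on all of the finite set `F`. -/
theorem Params.exists_agree (c : Params) (F : Finset (State c.tmax)) :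
    ∃ m₀ : ℕ, ∀ m ≥ m₀, ∀ f : StationaryPolicy (c.truncMDP m), f.IsOptimal →
      ∃ φ : StationaryPolicy c.mdp, φ.IsOptimal ∧ ∀ s ∈ F, AgreeAt f φ s := by
  by_contra! h
  obtain ⟨n, hn, hbad⟩ := extraction_of_frequently_atTop
    (frequently_atTop.2 fun m₀ => let ⟨m, hm, h'⟩ := h m₀; ⟨m, hm, h'⟩)
  choose f hf hbad using hbad
  obtain ⟨φ, k, hk, hφ⟩ := c.exists_limit hn f
  have hopt := c.isOptimal_of_limit (hn.comp hk) (fun j => f (k j)) (fun j => hf (k j)) φ hφ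
  obtain ⟨j, hj⟩ := ((eventually_all_finset F).2 fun s _ => hφ s).exists
  obtain ⟨s, hs, hne⟩ := hbad (k j) φ hopt
  exact hne (hj s hs)

end Limit

end AoII

theorem theorem5 (c : AoII.Params) :
    -- every truncated process has an optimal stationary policy
    (∀ m : ℕ, ∃ f : AoII.StationaryPolicy (c.truncMDP m), f.IsOptimal) ∧
    -- a sequence of optimal policies has a limit point, and each limit point is optimal
    (∀ f : ∀ m : ℕ, AoII.StationaryPolicy (c.truncMDP m), (∀ m, (f m).IsOptimal) →
      (∃ φ : AoII.StationaryPolicy c.mdp, AoII.IsLimitPoint f φ) ∧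
      ∀ φ : AoII.StationaryPolicy c.mdp, AoII.IsLimitPoint f φ → φ.IsOptimal) ∧
    -- on each finite set of states, the optimal policies of the truncated processes
    -- eventually coincide with optimal policies of the original process
    (∀ F : Finset (AoII.State c.tmax), ∃ m₀ : ℕ, ∀ m ≥ m₀,
      ∀ f : AoII.StationaryPolicy (c.truncMDP m), f.IsOptimal →
        ∃ φ : AoII.StationaryPolicy c.mdp, φ.IsOptimal ∧ ∀ s ∈ F, AoII.AgreeAt f φ s) ∧
    -- relative value iteration on a truncated process halts, and for all small tolerances
    -- it returns an optimal policy of that process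
    (∀ (m : ℕ) (ref : AoII.TruncState c.tmax m),
      (∀ ε : ℝ, 0 < ε → ∃ f : AoII.StationaryPolicy (c.truncMDP m),
        (c.truncMDP m).RVIReturns ref ε f) ∧
      ∃ ε₀ : ℝ, 0 < ε₀ ∧ ∀ ε : ℝ, 0 < ε → ε ≤ ε₀ →
        ∀ f : AoII.StationaryPolicy (c.truncMDP m),
          (c.truncMDP m).RVIReturns ref ε f → f.IsOptimal) ∧
    -- hence its output approximates the optimal policies of the original process
    (∀ F : Finset (AoII.State c.tmax), ∃ m₀ : ℕ, ∀ m ≥ m₀, ∀ ref : AoII.TruncState c.tmax m,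
      ∃ ε₀ : ℝ, 0 < ε₀ ∧ ∀ ε : ℝ, 0 < ε → ε ≤ ε₀ →
        ∀ f : AoII.StationaryPolicy (c.truncMDP m), (c.truncMDP m).RVIReturns ref ε f →
          ∃ φ : AoII.StationaryPolicy c.mdp, φ.IsOptimal ∧ ∀ s ∈ F, AoII.AgreeAt f φ s) := by
  have hopt := fun m => (c.drift_truncMDP m).exists_isOptimal fun ε hε =>
    c.exists_rviReturns m _ hε
  refine ⟨fun m => (hopt m).1, fun f hf => ⟨?_, ?_⟩, c.exists_agree,
    fun m ref => ⟨fun ε hε => c.exists_rviReturns m ref hε, (hopt m).2 ref⟩, fun F => ?_⟩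
  · obtain ⟨φ, k, hk, hφ⟩ := c.exists_limit strictMono_id f
    exact ⟨φ, k, hk, hφ⟩
  · rintro φ ⟨n, hn, hφ⟩
    exact c.isOptimal_of_limit hn (fun k => f (n k)) (fun k => hf (n k)) φ hφ
  · obtain ⟨m₀, h⟩ := c.exists_agree F
    refine ⟨m₀, fun m hm ref => ?_⟩
    obtain ⟨ε₀, hε₀, hret⟩ := (hopt m).2 ref
    exact ⟨ε₀, hε₀, fun ε hε hle f hf => h m hm f (hret ε hε hle f hf)⟩
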